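/- Let $n\ge 2$ and let $\Omega\subset\mathbb R^n$ be a domain, that is, a bounded connected open set. Let $\mathcal S^{n\times n}$ be the space of real symmetric $n\times n$ matrices, and let $F=F(x,s,p,M)\in C^1(\Omega\times\mathbb R\times\mathbb R^n\times\mathcal S^{n\times n})$ be elliptic (not necessarily uniformly): the symmetric matrix $$\Bigl(-\frac{\partial F}{\partial M_{ij}}(x,s,p,M)\Bigr)$$ is positive definite for all $(x,s,p,M)\in\Omega\times\mathbb R\times\mathbb R^n\times\mathcal S^{n\times n}$. Let $E\subset\Omega$ be a smooth closed (that is, compact and without boundary) embedded submanifold of dimension $k$, where $0\le k\le n-2$. For a $C^2$ function $w$ let $\lambda_1(\nabla^2 w)\le\lambda_2(\nabla^2 w)\le\dots\le\lambda_n(\nabla^2 w)$ be the eigenvalues of its Hessian, counted with multiplicity. Assume that $u\in C^2(\Omega\setminus E)$ and $v\in C^2(\Omega)$ satisfy, in $\Omega\setminus E$, $$\lambda_1(\nabla^2u)+\dots+\lambda_{k+2}(\nabla^2u)\le 0,$$ $$u>v,$$ $$F(x,u,\nabla u,\nabla^2u)\ge F(x,v,\nabla v,\nabla^2v).$$ Then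 $$\liminf_{\operatorname{dist}(x,E)\to0}(u-v)(x)>0,$$ where the lower limit is taken over $x\in\Omega\setminus E$ (the value $+\infty$ is allowed). -/

import Mathlib

open Set Filter Topology
open scoped ContDiff

/-! `C¹` regularity on the finite-dimensional space of matrices does not depend on the norm;
the entrywise supremum norm is used. -/
attribute [local instance] Matrix.normedAddCommGroup Matrix.normedSpace

/-- `E ⊆ ℝⁿ` is a smooth closed (i.e. compact, without boundary) embedded submanifold of
dimension `k`: it is compact, and around each of its points there is a smooth diffeomorphism `Φ`
between open subsets of `ℝⁿ` that straightens `E` to the coordinate plane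
`{z | zᵢ = 0 for all i ≥ k}` (coordinates numbered from `0`). -/
def IsSmoothClosedSubmanifold {n : ℕ} (k : ℕ) (E : Set (EuclideanSpace ℝ (Fin n))) : Prop :=
  IsCompact E ∧
    ∀ x ∈ E, ∃ Φ : OpenPartialHomeomorph (EuclideanSpace ℝ (Fin n)) (EuclideanSpace ℝ (Fin n)),
      x ∈ Φ.source ∧ ContDiffOn ℝ ∞ Φ Φ.source ∧ ContDiffOn ℝ ∞ Φ.symm Φ.target ∧
        ∀ y ∈ Φ.source, y ∈ E ↔ ∀ i : Fin n, k ≤ (i : ℕ) → Φ y i = 0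

/-- The Hessian matrix `∇²u(x) = (∂ᵢ∂ⱼu(x))`. -/
noncomputable def hessian {n : ℕ} (u : EuclideanSpace ℝ (Fin n) → ℝ)
    (x : EuclideanSpace ℝ (Fin n)) : Matrix (Fin n) (Fin n) ℝ :=
  Matrix.of fun i j =>
    fderiv ℝ (fun y => fderiv ℝ u y (EuclideanSpace.single j 1)) x (EuclideanSpace.single i 1)

/-- The eigenvalues of a real symmetric matrix in increasing order, with multiplicity, numbered
from `0`: `orderedEigenvalue A i` is `λᵢ₊₁(A)`. They are the sorted real roots of the
characteristic polynomial. -/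
noncomputable def orderedEigenvalue {n : ℕ} (A : Matrix (Fin n) (Fin n) ℝ) (i : ℕ) : ℝ :=
  (A.charpoly.roots.sort (· ≤ ·)).getD i 0

/-- `G` is the matrix `(∂F/∂Mᵢⱼ)(x, s, p, M)` of a function `F` of `(x, s, p, M)` with `M`
symmetric: `G` is symmetric and the derivative of `F` in `M` in each symmetric direction `N` is
`∑ᵢⱼ Gᵢⱼ Nᵢⱼ`. Only values of `F` at symmetric matrices enter. -/
def HasMatrixGradientAt {n : ℕ}
    (F : EuclideanSpace ℝ (Fin n) × ℝ × EuclideanSpace ℝ (Fin n) × Matrix (Fin n) (Fin n) ℝ → ℝ)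
    (G : Matrix (Fin n) (Fin n) ℝ) (x : EuclideanSpace ℝ (Fin n)) (s : ℝ)
    (p : EuclideanSpace ℝ (Fin n)) (M : Matrix (Fin n) (Fin n) ℝ) : Prop :=
  G.IsSymm ∧ ∀ N : Matrix (Fin n) (Fin n) ℝ, N.IsSymm →
    HasDerivAt (fun t : ℝ => F (x, s, p, M + t • N)) (∑ i, ∑ j, G i j * N i j) 0

/-- Ellipticity over `Ω`: the matrix `(-∂F/∂Mᵢⱼ)` is positive definite at every
`(x, s, p, M) ∈ Ω × ℝ × ℝⁿ × 𝒮ⁿˣⁿ`. -/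
def IsEllipticOn {n : ℕ}
    (F : EuclideanSpace ℝ (Fin n) × ℝ × EuclideanSpace ℝ (Fin n) × Matrix (Fin n) (Fin n) ℝ → ℝ)
    (Ω : Set (EuclideanSpace ℝ (Fin n))) : Prop :=
  ∀ x ∈ Ω, ∀ (s : ℝ) (p : EuclideanSpace ℝ (Fin n)) (M : Matrix (Fin n) (Fin n) ℝ), M.IsSymm →
    ∃ G : Matrix (Fin n) (Fin n) ℝ, HasMatrixGradientAt F G x s p M ∧ (-G).PosDef

/-! A barrier proof: `u - v` is first bounded below by a multiple of a defining function of `E`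
(Hopf-type argument), then by a positive constant, using that `E` is polar for `λ₁ + ⋯ + λ_{k+2}`. -/

/-! Everything is local near a point `x₀` of `E`. Let `r` be the length of the normal component `f`
of a straightening chart. Off `E`, the Hessian of `r` is at least `‖Bξ‖² / r - C‖ξ‖²`, where `B` is
the derivative of `f` with its component along `f` removed. The kernel of `B` has dimension `k + 1`.
Hence traces over orthonormal `(k + 2)`-frames are at least `c / r - C`, and the form dominates a
nonzero rank-one form (`IsSmoothClosedSubmanifold.exists_defining_function`).

Two comparisons follow. Near `E` nothing is known of `u` beyond `u > v`, so each barrier is made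
nonpositive on `E`; a violation then forces an interior maximum off `E`
(`exists_isLocalMax_of_pos`).

The first barrier is `η (r - ‖x - x₀‖²)`. At a maximum of barrier minus `u - v`, the Hessian of `u -
v` dominates `η` times a large rank-one form minus a bounded multiple of the identity. For small `η`
all arguments stay in a compact set, where ellipticity is uniform, and the rank-one term contradicts
the inequality for `F`. This gives `IsDefiningFunction.exists_linear_lower_bound`.

The second barrier is `η (r - 2‖x - x₀‖²) + δ + δ W`, where `W ≤ 0` is at most `-1` on `E` near
`x₀`, almost zero at a prescribed point off `E`, and has nonnegative traces over `(k + 2)`-frames.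
Such `W` exist (`exists_potential`) because `‖x‖⁻ᵏ` is the fundamental solution in dimension `k + 2`
and its integral over a `k`-dimensional set diverges logarithmically on the set. The linear bound
handles the sphere. At an interior maximum, the frame of the `k + 2` lowest eigenvectors of the
Hessian of `u` contradicts the large trace `c / r`. Letting `W` tend to zero at the chosen point
gives `IsDefiningFunction.exists_pos_lower_bound`; compactness of `E` finishes. -/

/-- The second derivative `D²w(x)(ξ, ξ)`. -/
noncomputable def secondDeriv {V : Type*} [NormedAddCommGroup V] [NormedSpace ℝ V]
    (w : V → ℝ) (x ξ : V) : ℝ := fderiv ℝ (fderiv ℝ w) x ξ ξ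

/-! ### Second derivatives along lines -/

section SecondDeriv

variable {V : Type*} [NormedAddCommGroup V] [NormedSpace ℝ V]

theorem ContDiffAt.eventually_differentiableAt_of_two {W : Type*} [NormedAddCommGroup W]
    [NormedSpace ℝ W] {w : V → W} {x : V}
    (hw : ContDiffAt ℝ 2 w x) : ∀ᶠ y in 𝓝 x, DifferentiableAt ℝ w y := by
  have h := hw.eventually (by simp)
  filter_upwards [h] with y hy
  exact hy.differentiableAt (by norm_num)

theorem ContDiffAt.differentiableAt_fderiv_of_two {W : Type*} [NormedAddCommGroup W]
    [NormedSpace ℝ W] {w : V → W} {x : V}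
    (hw : ContDiffAt ℝ 2 w x) : DifferentiableAt ℝ (fderiv ℝ w) x :=
  (hw.fderiv_right (m := 1) (by norm_num)).differentiableAt (by norm_num)

theorem secondDeriv_add {f g : V → ℝ} {x : V} (hf : ContDiffAt ℝ 2 f x)
    (hg : ContDiffAt ℝ 2 g x) (ξ : V) :
    secondDeriv (fun y => f y + g y) x ξ = secondDeriv f x ξ + secondDeriv g x ξ := by
  have h : fderiv ℝ (fun y => f y + g y) =ᶠ[𝓝 x] fun y => fderiv ℝ f y + fderiv ℝ g y := by
    filter_upwards [hf.eventually_differentiableAt_of_two,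
      hg.eventually_differentiableAt_of_two] with y h1 h2
    exact fderiv_fun_add h1 h2
  unfold secondDeriv
  rw [h.fderiv_eq, fderiv_fun_add hf.differentiableAt_fderiv_of_two
    hg.differentiableAt_fderiv_of_two]
  rfl

theorem secondDeriv_const_mul {f : V → ℝ} {x : V} (hf : ContDiffAt ℝ 2 f x) (c : ℝ) (ξ : V) :
    secondDeriv (fun y => c * f y) x ξ = c * secondDeriv f x ξ := by
  have h : fderiv ℝ (fun y => c * f y) =ᶠ[𝓝 x] fun y => c • fderiv ℝ f y := by
    filter_upwards [hf.eventually_differentiableAt_of_two] with y h1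
    exact fderiv_const_mul h1 c
  unfold secondDeriv
  rw [h.fderiv_eq, fderiv_fun_const_smul hf.differentiableAt_fderiv_of_two]
  rfl

theorem secondDeriv_sub {f g : V → ℝ} {x : V} (hf : ContDiffAt ℝ 2 f x)
    (hg : ContDiffAt ℝ 2 g x) (ξ : V) :
    secondDeriv (fun y => f y - g y) x ξ = secondDeriv f x ξ - secondDeriv g x ξ := by
  have h := secondDeriv_add hf (contDiffAt_const.mul hg : ContDiffAt ℝ 2 (fun y => (-1) * g y) x) ξ
  rw [secondDeriv_const_mul hg] at h
  convert h using 2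
  · ext y; ring
  · ring

theorem secondDeriv_const (c : ℝ) (x ξ : V) : secondDeriv (fun _ => c) x ξ = 0 := by
  have : fderiv ℝ (fun _ : V => c) = fun _ => 0 := by ext1 y; simp
  simp [secondDeriv, this]

theorem hasDerivAt_line (x ξ : V) (t : ℝ) : HasDerivAt (fun t : ℝ => x + t • ξ) ξ t := by
  simpa using ((hasDerivAt_id t).smul_const ξ).const_add x

theorem tendsto_line (x ξ : V) : Tendsto (fun t : ℝ => x + t • ξ) (𝓝 0) (𝓝 x) := by
  have := (hasDerivAt_line x ξ 0).continuousAt.tendsto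
  simpa using this

theorem hasDerivAt_comp_line {W : Type*} [NormedAddCommGroup W] [NormedSpace ℝ W] {w : V → W}
    {x ξ : V} {t : ℝ} (h : DifferentiableAt ℝ w (x + t • ξ)) :
    HasDerivAt (fun t : ℝ => w (x + t • ξ)) (fderiv ℝ w (x + t • ξ) ξ) t :=
  h.hasFDerivAt.comp_hasDerivAt t (hasDerivAt_line x ξ t)

theorem ContDiffAt.hasDerivAt_fderiv_line {W : Type*} [NormedAddCommGroup W] [NormedSpace ℝ W]
    {w : V → W} {x : V} (hw : ContDiffAt ℝ 2 w x) (ξ : V) :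
    HasDerivAt (fun t : ℝ => fderiv ℝ w (x + t • ξ) ξ) (fderiv ℝ (fderiv ℝ w) x ξ ξ) 0 := by
  have h := hw.differentiableAt_fderiv_of_two
  have h0 : DifferentiableAt ℝ (fderiv ℝ w) (x + (0 : ℝ) • ξ) := by simpa using h
  have h2 := (hasDerivAt_comp_line h0).clm_apply (hasDerivAt_const (0 : ℝ) ξ)
  simpa using h2

/-- The second derivative may be computed along lines. -/
theorem secondDeriv_eq_of_hasDerivAt {w : V → ℝ} {x ξ : V} (hw : ContDiffAt ℝ 2 w x)
    {g : ℝ → ℝ} {c : ℝ} (hg : ∀ᶠ t in 𝓝 (0 : ℝ), HasDerivAt (fun t => w (x + t • ξ)) (g t) t)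
    (hc : HasDerivAt g c 0) : secondDeriv w x ξ = c := by
  have h1 := hw.hasDerivAt_fderiv_line ξ
  refine h1.unique (hc.congr_of_eventuallyEq ?_)
  filter_upwards [hg, (tendsto_line x ξ).eventually hw.eventually_differentiableAt_of_two]
    with t ht ht'
  exact (hasDerivAt_comp_line ht').unique ht

/-- A positive second derivative along a line would make the point a local minimum as well, so the
restriction would be locally constant and its second derivative zero. -/
theorem IsLocalMax.secondDeriv_nonpos {w : V → ℝ} {x : V} (hw : ContDiffAt ℝ 2 w x)
    (hx : IsLocalMax w x) (ξ : V) : secondDeriv w x ξ ≤ 0 := by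
  by_contra! hpos
  set g : ℝ → ℝ := fun t => w (x + t • ξ) with hg
  have hmax : IsLocalMax g 0 := by
    have h0 := (tendsto_line x ξ).eventually hx
    filter_upwards [h0] with t ht
    simpa [hg] using ht
  have hd : deriv g =ᶠ[𝓝 0] fun t => fderiv ℝ w (x + t • ξ) ξ := by
    filter_upwards [(tendsto_line x ξ).eventually hw.eventually_differentiableAt_of_two] with t ht'
    exact (hasDerivAt_comp_line ht').deriv
  have hdd : deriv (deriv g) 0 = secondDeriv w x ξ := by
    rw [hd.deriv_eq]; exact (hw.hasDerivAt_fderiv_line ξ).deriv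
  have hcont : ContinuousAt g 0 := by
    have : ContinuousAt w (x + (0 : ℝ) • ξ) := by simpa using hw.continuousAt
    exact ContinuousAt.comp (f := fun t : ℝ => x + t • ξ) this (hasDerivAt_line x ξ 0).continuousAt
  have hmin : IsLocalMin g 0 :=
    isLocalMin_of_deriv_deriv_pos (by rw [hdd]; exact hpos) hmax.deriv_eq_zero hcont
  have hconst : g =ᶠ[𝓝 0] fun _ => g 0 := by
    filter_upwards [hmax, hmin] with t h1 h2
    exact le_antisymm h1 h2
  have : deriv (deriv g) 0 = 0 := by
    rw [hconst.deriv.deriv_eq]; simp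
  linarith

end SecondDeriv

/-! ### Hessian matrices and ordered eigenvalues -/

section Hessian

variable {n : ℕ}

theorem hessian_apply {w : EuclideanSpace ℝ (Fin n) → ℝ} {x : EuclideanSpace ℝ (Fin n)}
    (hw : ContDiffAt ℝ 2 w x) (i j : Fin n) :
    hessian w x i j = fderiv ℝ (fderiv ℝ w) x (EuclideanSpace.single i 1)
      (EuclideanSpace.single j 1) := by
  have h := hw.differentiableAt_fderiv_of_two
  simp only [hessian, Matrix.of_apply]
  rw [fderiv_clm_apply h (differentiableAt_const _)]
  simp

theorem hessian_isSymm {w : EuclideanSpace ℝ (Fin n) → ℝ} {x : EuclideanSpace ℝ (Fin n)}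
    (hw : ContDiffAt ℝ 2 w x) : (hessian w x).IsSymm := by
  ext i j
  rw [Matrix.transpose_apply, hessian_apply hw, hessian_apply hw]
  exact hw.isSymmSndFDerivAt (by simp) _ _

theorem hessian_quadratic {w : EuclideanSpace ℝ (Fin n) → ℝ} {x : EuclideanSpace ℝ (Fin n)}
    (hw : ContDiffAt ℝ 2 w x) (ξ : EuclideanSpace ℝ (Fin n)) :
    ξ.ofLp ⬝ᵥ (hessian w x).mulVec ξ.ofLp = secondDeriv w x ξ := by
  have hξ : ξ = ∑ i, ξ i • EuclideanSpace.single i (1 : ℝ) := by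
    ext j; simp [Finset.sum_apply, Pi.single_apply]
  unfold secondDeriv
  conv_rhs => rw [hξ]
  simp only [map_sum, map_smul, _root_.sum_apply, _root_.smul_apply,
    dotProduct, Matrix.mulVec, Finset.mul_sum, smul_eq_mul, hessian_apply hw]
  refine (Finset.sum_congr rfl fun i _ => Finset.sum_congr rfl fun j _ => ?_).trans Finset.sum_comm
  ring

/-- The roots of the characteristic polynomial are the eigenvalues with multiplicity, so permuting
an orthonormal eigenbasis by the sorting permutation matches it with the sorted list. -/
theorem orderedEigenvalue_eq {A : Matrix (Fin n) (Fin n) ℝ} (hA : A.IsHermitian) :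
    ∃ b : OrthonormalBasis (Fin n) ℝ (EuclideanSpace ℝ (Fin n)), ∀ i : Fin n,
      A.mulVec (b i).ofLp = orderedEigenvalue A i • (b i).ofLp := by
  set σ := Tuple.sort hA.eigenvalues with hσ
  have hmono : Monotone (hA.eigenvalues ∘ σ) := Tuple.monotone_sort _
  have hsort : A.charpoly.roots.sort (· ≤ ·) = List.ofFn (hA.eigenvalues ∘ σ) := by
    have h1 : A.charpoly.roots = ((List.ofFn (hA.eigenvalues ∘ σ) : List ℝ) : Multiset ℝ) := by
      rw [hA.roots_charpoly_eq_eigenvalues]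
      have h2 : (Finset.univ.val.map σ : Multiset (Fin n)) = Finset.univ.val := by simp
      conv_lhs => rw [← h2]
      rw [Multiset.map_map, Fin.univ_val_map]
      rfl
    rw [h1, Multiset.coe_sort]
    apply List.mergeSort_of_pairwise
    simp_rw [decide_eq_true_eq, ← List.sortedLE_iff_pairwise]
    exact hmono.sortedLE_ofFn
  refine ⟨hA.eigenvectorBasis.reindex σ.symm, fun i => ?_⟩
  -- The sorted list has length `n`, so the default value `0` of `getD` is never reached.
  have h3 : orderedEigenvalue A i = hA.eigenvalues (σ i) := by
    simp [orderedEigenvalue, hsort]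
  rw [h3]
  simpa using hA.mulVec_eigenvectorBasis (σ i)

/-- An orthonormal family realizing the sum of the `m` smallest eigenvalues. -/
theorem exists_orthonormal_sum_orderedEigenvalue {A : Matrix (Fin n) (Fin n) ℝ}
    (hA : A.IsSymm) {m : ℕ} (hm : m ≤ n) :
    ∃ ξ : Fin m → EuclideanSpace ℝ (Fin n), Orthonormal ℝ ξ ∧
      ∑ i, (ξ i).ofLp ⬝ᵥ A.mulVec (ξ i).ofLp = ∑ i ∈ Finset.range m, orderedEigenvalue A i := by
  obtain ⟨b, hb⟩ := orderedEigenvalue_eq (A := A) (by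
    rw [Matrix.IsHermitian, Matrix.conjTranspose_eq_transpose_of_trivial]; exact hA)
  refine ⟨fun i => b (Fin.castLE hm i), b.orthonormal.comp _ (Fin.castLE_injective hm), ?_⟩
  rw [Finset.sum_range]
  refine Finset.sum_congr rfl fun i _ => ?_
  rw [hb, dotProduct_smul]
  have h1 : ‖b (Fin.castLE hm i)‖ = 1 := b.orthonormal.1 _
  have h2 : (b (Fin.castLE hm i)).ofLp ⬝ᵥ (b (Fin.castLE hm i)).ofLp = 1 := by
    have := EuclideanSpace.real_norm_sq_eq (b (Fin.castLE hm i))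
    rw [h1] at this
    simp only [dotProduct]
    rw [← Finset.sum_congr rfl fun j _ => sq _]
    linarith
  simp [h2]

end Hessian

/-! ### Interior maxima off a closed set -/

/-- A function on a closed ball minus a closed set `E`, dominated by a continuous function that is
nonpositive on `E`, and nonpositive on the sphere: if it is positive somewhere, then it has a
positive interior local maximum off `E`. -/
theorem exists_isLocalMax_of_pos {V : Type*} [PseudoMetricSpace V] [ProperSpace V]
    {x₀ : V} {ρ : ℝ} {E : Set V} (hE : IsClosed E) {g ψ : V → ℝ}
    (hg : ContinuousOn g (Metric.closedBall x₀ ρ \ E))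
    (hψ : ContinuousOn ψ (Metric.closedBall x₀ ρ))
    (hgψ : ∀ x ∈ Metric.closedBall x₀ ρ \ E, g x ≤ ψ x)
    (hψE : ∀ x ∈ Metric.closedBall x₀ ρ ∩ E, ψ x ≤ 0)
    (hs : ∀ x ∈ Metric.sphere x₀ ρ \ E, g x ≤ 0)
    {y : V} (hy : y ∈ Metric.closedBall x₀ ρ \ E) (hgy : 0 < g y) :
    ∃ x ∈ Metric.ball x₀ ρ \ E, IsLocalMax g x ∧ 0 < g x := by
  -- Since `g ≤ ψ`, every point off `E` where `g` reaches `g y` lies in `T`. Since `ψ ≤ 0 < g y` on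
  -- `E`, the compact set `T` avoids `E`, so `g` is continuous on it.
  set T := Metric.closedBall x₀ ρ ∩ ψ ⁻¹' Ici (g y) with hT
  have hTc : IsCompact T := (isCompact_closedBall x₀ ρ).of_isClosed_subset
    (hψ.preimage_isClosed_of_isClosed Metric.isClosed_closedBall isClosed_Ici) inter_subset_left
  have hTsub : T ⊆ Metric.closedBall x₀ ρ \ E := fun x hx =>
    ⟨hx.1, fun hxE => absurd (hψE x ⟨hx.1, hxE⟩) (not_le.2 (lt_of_lt_of_le hgy hx.2))⟩
  obtain ⟨x, hxT, hx⟩ := hTc.exists_isMaxOn ⟨y, hy.1, hgψ y hy⟩ (hg.mono hTsub)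
  have hyx : g y ≤ g x := hx ⟨hy.1, hgψ y hy⟩
  have hpos : 0 < g x := hgy.trans_le hyx
  have hmax : ∀ z ∈ Metric.closedBall x₀ ρ \ E, g z ≤ g x := by
    intro z hz
    by_cases h : g y ≤ ψ z
    · exact hx ⟨hz.1, h⟩
    · exact ((hgψ z hz).trans (not_le.1 h).le).trans hyx
  have hxb : x ∈ Metric.ball x₀ ρ := by
    rcases (Metric.mem_closedBall.1 hxT.1).lt_or_eq with h | h
    · exact h
    · exact absurd (hs x ⟨h, (hTsub hxT).2⟩) (not_le.2 hpos)
  refine ⟨x, ⟨hxb, (hTsub hxT).2⟩, ?_, hpos⟩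
  filter_upwards [Metric.isOpen_ball.mem_nhds hxb, hE.isOpen_compl.mem_nhds (hTsub hxT).2]
    with z h1 h2
  exact hmax z ⟨Metric.ball_subset_closedBall h1, h2⟩

/-! ### Radial kernels and their partial traces -/

section RadialKernel

variable {V : Type*} [NormedAddCommGroup V] [InnerProductSpace ℝ V]

theorem contDiff_radial {g : ℝ → ℝ} (hgc : ∀ s, 0 ≤ s → ContDiffAt ℝ 2 g s) (y : V) :
    ContDiff ℝ 2 fun x => g (‖x - y‖ ^ 2) := by
  rw [contDiff_iff_contDiffAt]
  intro x
  exact ContDiffAt.comp x (hgc _ (by positivity))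
    ((contDiff_id.sub contDiff_const).norm_sq ℝ).contDiffAt

theorem secondDeriv_radial {g g' g'' : ℝ → ℝ} (hgc : ∀ s, 0 ≤ s → ContDiffAt ℝ 2 g s)
    (hg : ∀ s, 0 ≤ s → HasDerivAt g (g' s) s) (hg' : ∀ s, 0 ≤ s → HasDerivAt g' (g'' s) s)
    (y x ξ : V) :
    secondDeriv (fun x => g (‖x - y‖ ^ 2)) x ξ =
      2 * g' (‖x - y‖ ^ 2) * ‖ξ‖ ^ 2 + 4 * g'' (‖x - y‖ ^ 2) * inner ℝ (x - y) ξ ^ 2 := by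
  have hline : ∀ t : ℝ, HasDerivAt (fun t : ℝ => x + t • ξ - y) ξ t := fun t =>
    (hasDerivAt_line x ξ t).sub_const y
  have hsq : ∀ t : ℝ, HasDerivAt (fun t : ℝ => ‖x + t • ξ - y‖ ^ 2)
      (2 * inner ℝ (x + t • ξ - y) ξ) t := fun t => (hline t).norm_sq
  have hin : HasDerivAt (fun t : ℝ => inner ℝ (x + t • ξ - y) ξ) (‖ξ‖ ^ 2) 0 := by
    simpa using (hline 0).inner ℝ (hasDerivAt_const 0 ξ)
  refine secondDeriv_eq_of_hasDerivAt (contDiff_radial hgc y).contDiffAt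
    (g := fun t => g' (‖x + t • ξ - y‖ ^ 2) * (2 * inner ℝ (x + t • ξ - y) ξ))
    (Eventually.of_forall fun t => (hg _ (by positivity)).comp t (hsq t)) ?_
  have h1 := ((hg' (‖x + (0 : ℝ) • ξ - y‖ ^ 2) (by positivity)).comp (0 : ℝ) (hsq 0)).mul
    (hin.const_mul 2)
  refine HasDerivAt.congr_deriv h1 ?_
  simp
  ring

/-- The superposition kernels: if `g'' ≤ 0 ≤ m g' + 2 s g''`, then traces of the Hessian of
`g(‖x - y‖²)` over orthonormal `m`-frames are nonnegative. -/
theorem sum_secondDeriv_radial_nonneg {g g' g'' : ℝ → ℝ}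
    (hgc : ∀ s, 0 ≤ s → ContDiffAt ℝ 2 g s)
    (hg : ∀ s, 0 ≤ s → HasDerivAt g (g' s) s) (hg' : ∀ s, 0 ≤ s → HasDerivAt g' (g'' s) s)
    {m : ℕ} (h2 : ∀ s, 0 ≤ s → g'' s ≤ 0) (h1 : ∀ s, 0 ≤ s → 0 ≤ m * g' s + 2 * s * g'' s)
    (y x : V) {ξ : Fin m → V} (hξ : Orthonormal ℝ ξ) :
    0 ≤ ∑ i, secondDeriv (fun x => g (‖x - y‖ ^ 2)) x (ξ i) := by
  -- Bessel's inequality. As `g'' ≤ 0`, the worst frame is one whose span contains `x - y`, and it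
  -- gives `2 (m g' + 2 s g'')`.
  have hB : ∑ i, inner ℝ (x - y) (ξ i) ^ 2 ≤ ‖x - y‖ ^ 2 := by
    have := hξ.sum_inner_products_le (x - y) (s := Finset.univ)
    simpa [real_inner_comm] using this
  simp only [secondDeriv_radial hgc hg hg', hξ.1, Finset.sum_add_distrib, ← Finset.mul_sum]
  have hs : 0 ≤ ‖x - y‖ ^ 2 := by positivity
  have := mul_le_mul_of_nonpos_left hB (h2 _ hs)
  have := h1 _ hs
  simp only [one_pow, Finset.sum_const, Finset.card_univ, Fintype.card_fin, nsmul_eq_mul, mul_one]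
  nlinarith

end RadialKernel

/-! ### Logarithmic divergence of lattice sums -/

section Sums

variable {V : Type*} [NormedAddCommGroup V] [NormedSpace ℝ V]

theorem secondDeriv_sum {ι : Type*} (s : Finset ι) {f : ι → V → ℝ} {x : V}
    (hf : ∀ i ∈ s, ContDiffAt ℝ 2 (f i) x) (ξ : V) :
    secondDeriv (fun y => ∑ i ∈ s, f i y) x ξ = ∑ i ∈ s, secondDeriv (f i) x ξ := by
  classical
  induction s using Finset.induction_on with
  | empty => simpa using secondDeriv_const (0 : ℝ) x ξ
  | insert a s ha ih =>
    simp only [Finset.sum_insert ha]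
    rw [secondDeriv_add (hf a (by simp))
      (ContDiffAt.sum fun i hi => hf i (by simp [hi])), ih fun i hi => hf i (by simp [hi])]

/-- The lattice sum of `(1 + |l|)⁻ᵏ` over a `k`-dimensional cube dominates the harmonic sum. -/
theorem harmonic_le_sum_cube {k : ℕ} (hk : k ≠ 0) (N : ℕ) :
    ∑ m ∈ Finset.range N, (1 : ℝ) / (m + 1) ≤
      ∑ l ∈ Fintype.piFinset fun _ : Fin k => Finset.range N,
        (((1 : ℝ) + (Finset.univ.sup l : ℕ)) ^ k)⁻¹ := by
  induction N with
  | zero => simpa using Finset.sum_nonneg fun _ _ => by positivity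
  | succ N ih =>
    set P := Fintype.piFinset fun _ : Fin k => Finset.range N
    set Q := Fintype.piFinset fun _ : Fin k => Finset.range (N + 1)
    have hPQ : P ⊆ Q := Fintype.piFinset_subset _ _ fun _ => Finset.range_mono (Nat.le_succ N)
    rw [Finset.sum_range_succ, ← Finset.sum_sdiff hPQ, add_comm]
    refine add_le_add ?_ ih
    -- The outer shell has `(N + 1)ᵏ - Nᵏ ≥ (N + 1)ᵏ⁻¹` points, each contributing at least `(N +
    -- 1)⁻ᵏ`: one harmonic term.
    have hterm : ∀ l ∈ Q \ P, (((1 : ℝ) + N) ^ k)⁻¹ ≤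
        (((1 : ℝ) + (Finset.univ.sup l : ℕ)) ^ k)⁻¹ := by
      intro l hl
      have hl' : ∀ i, l i < N + 1 := fun i => by
        simpa using (Fintype.mem_piFinset.1 (Finset.mem_sdiff.1 hl).1) i
      have : Finset.univ.sup l ≤ N := Finset.sup_le fun i _ => Nat.lt_succ_iff.1 (hl' i)
      have : ((Finset.univ.sup l : ℕ) : ℝ) ≤ N := by exact_mod_cast this
      gcongr
    refine le_trans ?_ (Finset.card_nsmul_le_sum _ _ _ hterm)
    rw [Finset.card_sdiff_of_subset hPQ, nsmul_eq_mul]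
    have hcQ : Q.card = (N + 1) ^ k := by simp [Q, Fintype.card_piFinset]
    have hcP : P.card = N ^ k := by simp [P, Fintype.card_piFinset]
    rw [hcQ, hcP, Nat.cast_sub (Nat.pow_le_pow_left (Nat.le_succ N) k)]
    push_cast
    obtain ⟨j, rfl⟩ := Nat.exists_eq_succ_of_ne_zero hk
    have h1 : (N : ℝ) ^ j ≤ ((N : ℝ) + 1) ^ j := by gcongr; linarith
    have hpos : (0 : ℝ) < (N : ℝ) + 1 := by positivity
    rw [add_comm (1 : ℝ), ← div_eq_mul_inv, div_le_div_iff₀ hpos (by positivity)]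
    simp only [Nat.succ_eq_add_one, pow_succ]
    have hN : (0 : ℝ) ≤ N := by positivity
    nlinarith [mul_le_mul_of_nonneg_right h1 hN]

end Sums

section LatticeSum

variable {V : Type*} [NormedAddCommGroup V]

/-- Lower bound for the discretized Riesz potential of a Lipschitz image of a cube. -/
theorem riesz_sum_lower_bound {k : ℕ} (hk : k ≠ 0) {ψ : (Fin k → ℝ) → V} {L : NNReal}
    (hψ : LipschitzOnWith L ψ (Icc 0 3)) {N : ℕ} (hN : 0 < N) {w : Fin k → ℝ}
    (hw : w ∈ Icc (0 : Fin k → ℝ) 2) :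
    ((N : ℝ) / (L + 1)) ^ k * ∑ m ∈ Finset.range N, (1 : ℝ) / (m + 1) ≤
      ∑ j ∈ Fintype.piFinset fun _ : Fin k => Finset.range (3 * N),
        (‖ψ w - ψ fun i => (j i : ℝ) / N‖ ^ 2 + (1 / N) ^ 2) ^ (-(k / 2 : ℝ)) := by
  have hNr : (0 : ℝ) < N := by exact_mod_cast hN
  -- The grid corner just below `w`. Only the `Nᵏ` grid points `j₀ + l` with `0 ≤ lᵢ < N` are used;
  -- since `w ≤ 2` they stay below `3N`. This is why the parameter cube `[0, 3]ᵏ` is larger than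
  -- `[0, 2]ᵏ`.
  set j₀ : Fin k → ℕ := fun i => ⌊N * w i⌋₊ with hj₀
  have hwi : ∀ i, 0 ≤ w i ∧ w i ≤ 2 := fun i => ⟨hw.1 i, hw.2 i⟩
  have hj₀le : ∀ i, (j₀ i : ℝ) ≤ N * w i := fun i =>
    Nat.floor_le (mul_nonneg hNr.le (hwi i).1)
  have hj₀lt : ∀ i, N * w i < j₀ i + 1 := fun i => Nat.lt_floor_add_one _
  have hj₀b : ∀ i, j₀ i ≤ 2 * N := fun i => by
    have : (j₀ i : ℝ) ≤ 2 * N := (hj₀le i).trans (by nlinarith [(hwi i).2])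
    exact_mod_cast this
  set P := Fintype.piFinset fun _ : Fin k => Finset.range (3 * N)
  set Q := Fintype.piFinset fun _ : Fin k => Finset.range N
  set f : (Fin k → ℕ) → ℝ := fun j =>
    (‖ψ w - ψ fun i => (j i : ℝ) / N‖ ^ 2 + (1 / N) ^ 2) ^ (-(k / 2 : ℝ)) with hf
  have hf0 : ∀ j, 0 ≤ f j := fun j => by positivity
  have hQ : ∀ l ∈ Q, ∀ i, l i < N := fun l hl i => by
    simpa using Fintype.mem_piFinset.1 hl i
  have hsub : Q.image (fun l => j₀ + l) ⊆ P := by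
    intro j hj
    obtain ⟨l, hl, rfl⟩ := Finset.mem_image.1 hj
    refine Fintype.mem_piFinset.2 fun i => ?_
    have h1 := hQ l hl i
    have h2 := hj₀b i
    simp only [Pi.add_apply, Finset.mem_range]
    omega
  calc ((N : ℝ) / (L + 1)) ^ k * ∑ m ∈ Finset.range N, (1 : ℝ) / (m + 1)
      ≤ ((N : ℝ) / (L + 1)) ^ k * ∑ l ∈ Q, (((1 : ℝ) + (Finset.univ.sup l : ℕ)) ^ k)⁻¹ := by
        gcongr
        exact harmonic_le_sum_cube hk N
    _ = ∑ l ∈ Q, ((N : ℝ) / (L + 1)) ^ k * (((1 : ℝ) + (Finset.univ.sup l : ℕ)) ^ k)⁻¹ := by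
        rw [Finset.mul_sum]
    _ ≤ ∑ l ∈ Q, f (j₀ + l) := by
        refine Finset.sum_le_sum fun l hl => ?_
        set s : ℝ := 1 + (Finset.univ.sup l : ℕ) with hs
        have hs1 : 1 ≤ s := by rw [hs]; linarith [(Nat.cast_nonneg (Finset.univ.sup l) : (0:ℝ) ≤ _)]
        have hli : ∀ i, (l i : ℝ) ≤ s - 1 := fun i => by
          have : l i ≤ Finset.univ.sup l := Finset.le_sup (Finset.mem_univ i)
          rw [hs]; simpa using (by exact_mod_cast this : (l i : ℝ) ≤ (Finset.univ.sup l : ℕ))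
        set z : Fin k → ℝ := fun i => ((j₀ + l) i : ℝ) / N with hz
        have hzmem : z ∈ Icc (0 : Fin k → ℝ) 3 := by
          refine ⟨fun i => by simp only [hz, Pi.zero_apply]; positivity, fun i => ?_⟩
          have h1 := hQ l hl i
          have h2 := hj₀b i
          have h3 : ((j₀ + l) i : ℝ) ≤ 3 * N := by
            have : (j₀ + l) i ≤ 3 * N := by simp only [Pi.add_apply]; omega
            exact_mod_cast this
          simp only [hz, Pi.ofNat_apply]
          rw [div_le_iff₀ hNr]; exact h3
        have hwmem : w ∈ Icc (0 : Fin k → ℝ) 3 :=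
          ⟨hw.1, fun i => (hwi i).2.trans (by simp only [Pi.ofNat_apply]; norm_num)⟩
        have hwz : ‖w - z‖ ≤ s / N := by
          rw [pi_norm_le_iff_of_nonneg (by positivity)]
          intro i
          have h1 := hj₀le i
          have h2 := hj₀lt i
          have h3 := hli i
          have h4 : (0 : ℝ) ≤ l i := by positivity
          have h5 : (w - z) i = (N * w i - (j₀ i + l i)) / N := by
            simp only [hz, Pi.sub_apply, Pi.add_apply, Nat.cast_add]
            field_simp
          rw [h5, Real.norm_eq_abs, abs_div, abs_of_pos hNr]
          gcongr
          rw [abs_le]; constructor <;> linarith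
        have hdist : ‖ψ w - ψ z‖ ≤ L * (s / N) := by
          have := hψ.dist_le_mul w hwmem z hzmem
          rw [dist_eq_norm, dist_eq_norm] at this
          exact this.trans (by gcongr)
        -- The regularization `1 / N` equals the grid spacing, so it only changes `L` to `L + 1`,
        -- uniformly down to the nearest grid point.
        have hbase : ‖ψ w - ψ z‖ ^ 2 + (1 / N) ^ 2 ≤ ((L + 1) * s / N : ℝ) ^ 2 := by
          have h1 : ‖ψ w - ψ z‖ ^ 2 ≤ (L * (s / N)) ^ 2 := by gcongr
          have h2 : ((1 : ℝ) / N) ^ 2 ≤ (s / N) ^ 2 := by gcongr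
          have h3 : ((L + 1) * s / N : ℝ) ^ 2 =
            (L * (s / N)) ^ 2 + (s / N) ^ 2 + 2 * L * (s / N) ^ 2 := by ring
          have h4 : (0 : ℝ) ≤ 2 * L * (s / N) ^ 2 := by positivity
          linarith
        have hB : (0 : ℝ) < (L + 1) * s / N := by positivity
        have hpow : (((L + 1) * s / N : ℝ) ^ 2) ^ (-(k / 2 : ℝ)) =
            ((N : ℝ) / (L + 1)) ^ k * (s ^ k)⁻¹ := by
          rw [← Real.rpow_natCast _ 2, ← Real.rpow_mul hB.le]
          have : ((2 : ℕ) : ℝ) * -(k / 2 : ℝ) = -(k : ℝ) := by push_cast; ring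
          rw [this, Real.rpow_neg hB.le, Real.rpow_natCast, ← inv_pow, ← inv_pow, ← mul_pow]
          congr 1
          field_simp
        rw [← hpow]
        exact Real.rpow_le_rpow_of_nonpos (by positivity) hbase
          (by have : (0 : ℝ) ≤ k := by positivity
              linarith)
    _ = ∑ j ∈ Q.image (fun l => j₀ + l), f j :=
        (Finset.sum_image fun a _ b _ h => add_left_cancel h).symm
    _ ≤ ∑ j ∈ P, f j := Finset.sum_le_sum_of_subset_of_nonneg hsub fun j _ _ => hf0 j

end LatticeSum

/-! ### Polarity of `k`-dimensional sets for traces over `(k + 2)`-frames -/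

section Potential

variable {V : Type*} [NormedAddCommGroup V] [InnerProductSpace ℝ V]

/-- With `g(s) = -(s + τ)^(-k/2)` and frames of size `k + 2`, the quantity `(k + 2) g' + 2 s g''`
equals `(k/2)(k + 2) τ (s + τ)^(-k/2 - 2)`: the terms without `τ` cancel exactly in dimension `k +
2`. For `k = 0` the kernel is constant, and the logarithm replaces it. -/
theorem riesz_kernel_sum_nonneg (k : ℕ) {τ : ℝ} (hτ : 0 < τ) (y x : V)
    {ξ : Fin (k + 2) → V} (hξ : Orthonormal ℝ ξ) :
    0 ≤ ∑ i, secondDeriv (fun x => -(‖x - y‖ ^ 2 + τ) ^ (-(k / 2 : ℝ))) x (ξ i) := by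
  set a : ℝ := -(k / 2 : ℝ) with ha
  have hpos : ∀ s : ℝ, 0 ≤ s → 0 < s + τ := fun s hs => by linarith
  have hd : ∀ (b s : ℝ), 0 ≤ s → HasDerivAt (fun s => (s + τ) ^ b) (b * (s + τ) ^ (b - 1)) s := by
    intro b s hs
    simpa using ((hasDerivAt_id s).add_const τ).rpow_const (p := b) (Or.inl (hpos s hs).ne')
  refine sum_secondDeriv_radial_nonneg (g := fun s => -(s + τ) ^ a)
    (g' := fun s => -(a * (s + τ) ^ (a - 1)))
    (g'' := fun s => -(a * ((a - 1) * (s + τ) ^ (a - 1 - 1))))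
    (fun s hs => ?_) (fun s hs => (hd a s hs).neg)
    (fun s hs => ((hd (a - 1) s hs).const_mul a).neg) (fun s hs => ?_) (fun s hs => ?_) y x hξ
  · exact ((contDiffAt_id.add contDiffAt_const).rpow_const_of_ne (hpos s hs).ne').neg
  · have h1 := Real.rpow_pos_of_pos (hpos s hs) (a - 1 - 1)
    have h2 : 0 ≤ a * (a - 1) := by
      have : (0 : ℝ) ≤ k := by positivity
      rw [ha]; nlinarith
    nlinarith [mul_nonneg h2 h1.le]
  · have h1 := Real.rpow_pos_of_pos (hpos s hs) (a - 1 - 1)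
    have h3 : (s + τ) ^ (a - 1) = (s + τ) ^ (a - 1 - 1) * (s + τ) := by
      rw [← Real.rpow_add_one (hpos s hs).ne']; congr 1; ring
    rw [h3]
    have hk : (0 : ℝ) ≤ k := by positivity
    have h4 : ((k + 2 : ℕ) : ℝ) * -(a * ((s + τ) ^ (a - 1 - 1) * (s + τ))) +
        2 * s * -(a * ((a - 1) * (s + τ) ^ (a - 1 - 1))) =
        (k / 2) * (k + 2) * ((s + τ) ^ (a - 1 - 1) * τ) := by
      rw [ha]; push_cast; ring
    rw [h4]
    positivity

theorem log_kernel_sum_nonneg {τ R : ℝ} (hτ : 0 < τ) (y x : V)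
    {ξ : Fin 2 → V} (hξ : Orthonormal ℝ ξ) :
    0 ≤ ∑ i, secondDeriv (fun x => Real.log (‖x - y‖ ^ 2 + τ) - R) x (ξ i) := by
  have hpos : ∀ s : ℝ, 0 ≤ s → 0 < s + τ := fun s hs => by linarith
  refine sum_secondDeriv_radial_nonneg (g := fun s => Real.log (s + τ) - R)
    (g' := fun s => (s + τ)⁻¹) (g'' := fun s => -1 / (s + τ) ^ 2)
    (fun s hs => ?_) (fun s hs => ?_) (fun s hs => ?_) (fun s hs => ?_) (fun s hs => ?_) y x hξ
  · exact ((contDiffAt_id.add contDiffAt_const).log (hpos s hs).ne').sub contDiffAt_const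
  · simpa using (((hasDerivAt_id s).add_const τ).log (hpos s hs).ne').sub_const R
  · exact ((hasDerivAt_id s).add_const τ).inv (hpos s hs).ne'
  · have := hpos s hs
    rw [neg_div]
    exact neg_nonpos.2 (by positivity)
  · have := hpos s hs
    have h : ((2 : ℕ) : ℝ) * (s + τ)⁻¹ + 2 * s * (-1 / (s + τ) ^ 2) = 2 * τ / (s + τ) ^ 2 := by
      push_cast; field_simp; ring
    rw [h]; positivity

/-- A `k`-dimensional Lipschitz image of a cube is a polar set for the operator
`λ₁ + ⋯ + λ_{k+2}`. -/
theorem exists_potential {k : ℕ} {ψ : (Fin k → ℝ) → V} {L : NNReal}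
    (hψ : LipschitzOnWith L ψ (Icc 0 3)) {p : V} (hp : ∀ w ∈ Icc (0 : Fin k → ℝ) 3, p ≠ ψ w)
    (x₀ : V) (ρ : ℝ) {ε : ℝ} (hε : 0 < ε) :
    ∃ W : V → ℝ, ContDiff ℝ 2 W ∧ (∀ x ∈ Metric.closedBall x₀ ρ, W x ≤ 0) ∧ -ε ≤ W p ∧
      (∀ w ∈ Icc (0 : Fin k → ℝ) 2, W (ψ w) ≤ -1) ∧
      ∀ (x : V) (ξ : Fin (k + 2) → V), Orthonormal ℝ ξ → 0 ≤ ∑ i, secondDeriv W x (ξ i) := by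
  obtain ⟨d, hd, hpd⟩ : ∃ d : ℝ, 0 < d ∧ ∀ w ∈ Icc (0 : Fin k → ℝ) 3, d ≤ ‖p - ψ w‖ :=
    isCompact_Icc.exists_forall_le' ((continuousOn_const.sub hψ.continuousOn).norm)
      fun w hw => norm_pos_iff.2 (sub_ne_zero.2 (hp w hw))
  rcases eq_or_ne k 0 with rfl | hk
  · set q := ψ 0 with hq
    have hψq : ∀ w : Fin 0 → ℝ, ψ w = q := fun w => by rw [hq, Subsingleton.elim w 0]
    have hdp : d ≤ ‖p - q‖ := hpd 0 (by simp)
    -- `R` bounds `‖x - q‖² + τ` on the ball, making the normalized logarithm nonpositive there.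
    set R : ℝ := (|ρ| + ‖x₀ - q‖) ^ 2 + 1 with hR
    have hR1 : 1 ≤ R := by rw [hR]; nlinarith [sq_nonneg (|ρ| + ‖x₀ - q‖)]
    have hlogR : 0 ≤ Real.log R := Real.log_nonneg hR1
    set D : ℝ := Real.log R - Real.log (d ^ 2) with hD
    -- With `τ = exp (-t)` and normalization `1 / (log R + t)`, the value at `q` is exactly `-1`,
    -- while at `p` it is at least `-D / (log R + t)`, which this `t` makes at least `-ε`.
    set t : ℝ := |D| / ε + 1 with ht
    have ht0 : 0 < t := by positivity
    set τ : ℝ := Real.exp (-t) with hτdef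
    have hτ : 0 < τ := Real.exp_pos _
    have hτ1 : τ ≤ 1 := Real.exp_le_one_iff.2 (by linarith)
    have hlogτ : Real.log τ = -t := Real.log_exp _
    set c : ℝ := (Real.log R + t)⁻¹ with hc
    have hsum : 0 < Real.log R + t := by linarith
    have hc0 : 0 < c := inv_pos.2 hsum
    have hWc : ContDiff ℝ 2 fun x => Real.log (‖x - q‖ ^ 2 + τ) - Real.log R :=
      contDiff_radial (g := fun s => Real.log (s + τ) - Real.log R) (fun s hs =>
        ((contDiffAt_id.add contDiffAt_const).log
          (add_pos_of_nonneg_of_pos hs hτ).ne').sub contDiffAt_const) q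
    refine ⟨fun x => c * (Real.log (‖x - q‖ ^ 2 + τ) - Real.log R), contDiff_const.mul hWc,
      fun x hx => ?_, ?_, fun w _ => ?_, fun x ξ hξ => ?_⟩
    · refine mul_nonpos_of_nonneg_of_nonpos hc0.le (sub_nonpos.2 (Real.log_le_log (by positivity) ?_))
      have h1 : ‖x - q‖ ≤ |ρ| + ‖x₀ - q‖ := by
        have h2 : ‖x - x₀‖ ≤ ρ := by simpa [dist_eq_norm] using hx
        have h3 := norm_add_le (x - x₀) (x₀ - q)
        rw [sub_add_sub_cancel] at h3
        linarith [le_abs_self ρ]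
      rw [hR]
      gcongr
    · have h1 : Real.log (d ^ 2) ≤ Real.log (‖p - q‖ ^ 2 + τ) := by
        refine Real.log_le_log (by positivity) ?_
        have : d ^ 2 ≤ ‖p - q‖ ^ 2 := by gcongr
        linarith
      have h2 : D ≤ ε * (Real.log R + t) := by
        have h3 : |D| = ε * (t - 1) := by rw [ht]; field_simp; ring
        have h4 := le_abs_self D
        nlinarith
      have h5 : c * D ≤ ε := by
        rw [hc, inv_mul_le_iff₀ hsum]; linarith
      nlinarith
    · simp only [hψq w, sub_self, norm_zero]
      rw [show (0 : ℝ) ^ 2 + τ = τ by ring, hlogτ, hc,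
        show -t - Real.log R = -(Real.log R + t) by ring, mul_neg, inv_mul_cancel₀ hsum.ne']
    · simp only [secondDeriv_const_mul hWc.contDiffAt, ← Finset.mul_sum]
      exact mul_nonneg hc0.le (log_kernel_sum_nonneg hτ q x hξ)
  · have hL : (0 : ℝ) < L + 1 := by positivity
    -- The normalized potential at `p` is at least `-(3 (L + 1) / d)ᵏ / H`: the `(3N)ᵏ` terms are
    -- each at most `d⁻ᵏ`, against `(N / (L + 1))ᵏ H` on the set. Divergence of the harmonic sum `H`
    -- makes this at least `-ε`.
    obtain ⟨N, hN, hN0⟩ : ∃ N : ℕ, (3 * (L + 1) / d) ^ k / ε ≤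
        ∑ m ∈ Finset.range N, (1 : ℝ) / (m + 1) ∧ 0 < N :=
      ((Real.tendsto_sum_range_one_div_nat_succ_atTop.eventually_ge_atTop _).and
        (eventually_gt_atTop 0)).exists
    have hNr : (0 : ℝ) < N := by exact_mod_cast hN0
    set H := ∑ m ∈ Finset.range N, (1 : ℝ) / (m + 1)
    have hH : 0 < H := lt_of_lt_of_le (by positivity) hN
    set P := Fintype.piFinset fun _ : Fin k => Finset.range (3 * N) with hPdef
    set y : (Fin k → ℕ) → V := fun j => ψ fun i => (j i : ℝ) / N
    set c : ℝ := (((N : ℝ) / (L + 1)) ^ k * H)⁻¹ with hc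
    have hc0 : 0 < c := by positivity
    have hτ : (0 : ℝ) < (1 / N) ^ 2 := by positivity
    set f : (Fin k → ℕ) → V → ℝ := fun j x => -(‖x - y j‖ ^ 2 + (1 / N) ^ 2) ^ (-(k / 2 : ℝ))
      with hf
    have hfc : ∀ j, ContDiff ℝ 2 (f j) := fun j =>
      contDiff_radial (g := fun s => -(s + (1 / N) ^ 2) ^ (-(k / 2 : ℝ))) (fun s hs =>
        ((contDiffAt_id.add contDiffAt_const).rpow_const_of_ne
          (add_pos_of_nonneg_of_pos hs hτ).ne').neg) (y j)
    have hsumc : ContDiff ℝ 2 fun x => ∑ j ∈ P, f j x := ContDiff.sum fun j _ => hfc j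
    refine ⟨fun x => c * ∑ j ∈ P, f j x, contDiff_const.mul hsumc, fun x _ => ?_, ?_,
      fun w hw => ?_, fun x ξ hξ => ?_⟩
    · refine mul_nonpos_of_nonneg_of_nonpos hc0.le (Finset.sum_nonpos fun j _ => ?_)
      exact neg_nonpos.2 (by positivity)
    · have h1 : ∀ j ∈ P, -(d ^ k)⁻¹ ≤ f j p := by
        intro j hj
        have hjm : (fun i => (j i : ℝ) / N) ∈ Icc (0 : Fin k → ℝ) 3 := by
          refine ⟨fun i => by simp only [Pi.zero_apply]; positivity, fun i => ?_⟩
          have h3 : j i < 3 * N := by simpa using Fintype.mem_piFinset.1 hj i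
          have h4 : (j i : ℝ) ≤ 3 * N := by exact_mod_cast h3.le
          simp only [Pi.ofNat_apply]
          rw [div_le_iff₀ hNr]; exact h4
        have h2 := hpd _ hjm
        have h3 : d ^ 2 ≤ ‖p - y j‖ ^ 2 + (1 / N) ^ 2 := by
          have : d ^ 2 ≤ ‖p - y j‖ ^ 2 := by gcongr
          linarith
        have h4 : (d ^ 2) ^ (-(k / 2 : ℝ)) = (d ^ k)⁻¹ := by
          rw [← Real.rpow_natCast _ 2, ← Real.rpow_mul hd.le]
          have : ((2 : ℕ) : ℝ) * -(k / 2 : ℝ) = -(k : ℝ) := by push_cast; ring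
          rw [this, Real.rpow_neg hd.le, Real.rpow_natCast]
        rw [← h4]
        refine neg_le_neg (Real.rpow_le_rpow_of_nonpos (by positivity) h3 ?_)
        have : (0 : ℝ) ≤ k := by positivity
        linarith
      have h2 := Finset.card_nsmul_le_sum _ _ _ h1
      have hcard : P.card = (3 * N) ^ k := by simp [hPdef, Fintype.card_piFinset]
      rw [hcard, nsmul_eq_mul] at h2
      push_cast at h2
      refine le_trans ?_ (mul_le_mul_of_nonneg_left h2 hc0.le)
      have h5 : c * ((3 * (N : ℝ)) ^ k * -(d ^ k)⁻¹) = -((3 * (L + 1) / d) ^ k / H) := by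
        rw [hc]
        simp only [div_pow, mul_pow]
        field_simp
      rw [h5, neg_le_neg_iff, div_le_iff₀ hH]
      rw [div_le_iff₀ hε] at hN
      linarith
    · have h1 := riesz_sum_lower_bound hk hψ hN0 hw
      have h2 : ∑ j ∈ P, f j (ψ w) ≤ -(((N : ℝ) / (L + 1)) ^ k * H) := by
        simp only [hf, Finset.sum_neg_distrib, neg_le_neg_iff]
        exact h1
      calc c * ∑ j ∈ P, f j (ψ w) ≤ c * -(((N : ℝ) / (L + 1)) ^ k * H) := by gcongr
        _ = -1 := by rw [hc, mul_neg, inv_mul_cancel₀ (by positivity)]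
    · simp only [secondDeriv_const_mul hsumc.contDiffAt,
        secondDeriv_sum P (fun j _ => (hfc j).contDiffAt), ← Finset.mul_sum]
      rw [Finset.sum_comm]
      exact mul_nonneg hc0.le (Finset.sum_nonneg fun j _ => riesz_kernel_sum_nonneg k hτ _ _ hξ)

end Potential

/-! ### Derivatives of the length of a vector-valued map -/

section NormComp

variable {V W : Type*} [NormedAddCommGroup V] [NormedSpace ℝ V] [NormedAddCommGroup W]
  [InnerProductSpace ℝ W]

theorem hasDerivAt_norm_comp {F : ℝ → W} {F' : W} {t : ℝ} (hF : HasDerivAt F F' t)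
    (h0 : F t ≠ 0) : HasDerivAt (fun t => ‖F t‖) (inner ℝ (F t) F' / ‖F t‖) t := by
  have h1 := hF.norm_sq.sqrt (by positivity)
  simp only [Real.sqrt_sq (norm_nonneg _)] at h1
  refine h1.congr_deriv ?_
  field_simp

theorem norm_fderiv_norm_comp_le {f : V → W} {x : V} (hf : ContDiffAt ℝ 2 f x) (h0 : f x ≠ 0) :
    ‖fderiv ℝ (fun y => ‖f y‖) x‖ ≤ ‖fderiv ℝ f x‖ := by
  have hd : DifferentiableAt ℝ f x := hf.differentiableAt (by norm_num)
  refine ContinuousLinearMap.opNorm_le_bound _ (norm_nonneg _) fun ξ => ?_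
  have h1 := hasDerivAt_comp_line (w := fun y => ‖f y‖) (x := x) (ξ := ξ) (t := 0)
    (by simpa using hd.norm ℝ h0)
  have h2 := hasDerivAt_norm_comp (hasDerivAt_comp_line (w := f) (x := x) (ξ := ξ) (t := 0)
    (by simpa using hd)) (by simpa using h0)
  have h3 := h1.unique h2
  simp only [zero_smul, add_zero] at h3
  rw [h3, norm_div, norm_norm, div_le_iff₀ (norm_pos_iff.2 h0), mul_comm]
  exact (norm_inner_le_norm _ _).trans
    (mul_le_mul_of_nonneg_left ((fderiv ℝ f x).le_opNorm ξ) (norm_nonneg _))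

theorem secondDeriv_norm_comp {f : V → W} {x : V} (hf : ContDiffAt ℝ 2 f x) (h0 : f x ≠ 0)
    (ξ : V) : secondDeriv (fun y => ‖f y‖) x ξ =
      ((inner ℝ (f x) (fderiv ℝ (fderiv ℝ f) x ξ ξ) + ‖fderiv ℝ f x ξ‖ ^ 2) * ‖f x‖ -
        inner ℝ (f x) (fderiv ℝ f x ξ) * (inner ℝ (f x) (fderiv ℝ f x ξ) / ‖f x‖)) /
          ‖f x‖ ^ 2 := by
  have hne : ∀ᶠ t in 𝓝 (0 : ℝ), f (x + t • ξ) ≠ 0 :=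
    (tendsto_line x ξ).eventually (hf.continuousAt.eventually_ne h0)
  refine secondDeriv_eq_of_hasDerivAt (hf.norm ℝ h0)
    (g := fun t => inner ℝ (f (x + t • ξ)) (fderiv ℝ f (x + t • ξ) ξ) / ‖f (x + t • ξ)‖) ?_ ?_
  · filter_upwards [hne, (tendsto_line x ξ).eventually hf.eventually_differentiableAt_of_two]
      with t ht hd
    exact hasDerivAt_norm_comp (hasDerivAt_comp_line hd) ht
  · have h1 : HasDerivAt (fun t : ℝ => f (x + t • ξ)) (fderiv ℝ f x ξ) 0 := by
      have := hasDerivAt_comp_line (w := f) (x := x) (ξ := ξ) (t := 0)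
        (by simpa using hf.differentiableAt (by norm_num))
      simpa using this
    have h2 := (h1.inner ℝ (hf.hasDerivAt_fderiv_line ξ)).div
      (hasDerivAt_norm_comp h1 (by simpa using h0)) (by simpa using h0)
    refine h2.congr_deriv ?_
    simp

/-- With `e = f / ‖f‖`, the Hessian of `‖f‖` is the squared length of the part of `Df ξ` orthogonal
to `e`, divided by `‖f‖`, plus `⟨e, D²f(ξ, ξ)⟩`. The singular term is thus nonnegative and the
remainder bounded. -/
theorem secondDeriv_norm_comp_ge {f : V → W} {x : V} (hf : ContDiffAt ℝ 2 f x) (h0 : f x ≠ 0)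
    (ξ : V) :
    ‖fderiv ℝ f x ξ - inner ℝ (‖f x‖⁻¹ • f x) (fderiv ℝ f x ξ) • (‖f x‖⁻¹ • f x)‖ ^ 2 / ‖f x‖ -
      ‖fderiv ℝ (fderiv ℝ f) x‖ * ‖ξ‖ ^ 2 ≤ secondDeriv (fun y => ‖f y‖) x ξ := by
  have hr : 0 < ‖f x‖ := norm_pos_iff.2 h0
  rw [secondDeriv_norm_comp hf h0]
  set D := fderiv ℝ (fderiv ℝ f) x
  set a := fderiv ℝ f x ξ
  set r := ‖f x‖
  have h1 : |inner ℝ (f x) (D ξ ξ)| ≤ r * (‖D‖ * ‖ξ‖ ^ 2) := by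
    refine (abs_real_inner_le_norm _ _).trans (mul_le_mul_of_nonneg_left ?_ hr.le)
    rw [sq, ← mul_assoc]
    exact D.le_opNorm₂ ξ ξ
  have h2 : ‖a - inner ℝ (r⁻¹ • f x) a • (r⁻¹ • f x)‖ ^ 2 = ‖a‖ ^ 2 - (inner ℝ (f x) a / r) ^ 2 := by
    rw [norm_sub_sq_real]
    simp only [inner_smul_left, inner_smul_right, norm_smul, real_inner_comm (f x) a]
    have : ‖f x‖ = r := rfl
    simp only [this, norm_mul, norm_inv, Real.norm_eq_abs, abs_of_pos hr, mul_pow, sq_abs]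
    simp
    field_simp
    ring
  rw [h2]
  have h3 := (abs_le.1 h1).1
  have h4 : ((inner ℝ (f x) (D ξ ξ) + ‖a‖ ^ 2) * r - inner ℝ (f x) a * (inner ℝ (f x) a / r)) / r ^ 2
      = (‖a‖ ^ 2 - (inner ℝ (f x) a / r) ^ 2) / r + inner ℝ (f x) (D ξ ξ) / r := by
    field_simp
    ring
  rw [h4, sub_eq_add_neg]
  gcongr
  rw [le_div_iff₀ hr]
  linarith

end NormComp

/-! ### Nondegeneracy of the singular part of the Hessian -/

section NormalProjection

variable {n : ℕ}

/-- The projection onto the coordinates with index at least `k`. -/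
noncomputable def normalProj (n k : ℕ) :
    EuclideanSpace ℝ (Fin n) →L[ℝ] EuclideanSpace ℝ (Fin n) :=
  ∑ i ∈ Finset.univ.filter fun i : Fin n => k ≤ (i : ℕ),
    (EuclideanSpace.proj i : EuclideanSpace ℝ (Fin n) →L[ℝ] ℝ).smulRight
      (EuclideanSpace.single i (1 : ℝ))

theorem normalProj_apply (k : ℕ) (z : EuclideanSpace ℝ (Fin n)) (i : Fin n) :
    normalProj n k z i = if k ≤ (i : ℕ) then z i else 0 := by
  simp [normalProj, Finset.sum_apply, Pi.single_apply]

theorem normalProj_eq_zero_iff {k : ℕ} {z : EuclideanSpace ℝ (Fin n)} :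
    normalProj n k z = 0 ↔ ∀ i : Fin n, k ≤ (i : ℕ) → z i = 0 := by
  constructor
  · intro h i hi
    have := normalProj_apply k z i
    rw [h] at this
    simpa [hi] using this.symm
  · intro h
    ext i
    rw [normalProj_apply]
    split_ifs with hi
    · simpa using h i hi
    · simp

/-- An injective image of `k + 2` independent vectors is not carried by the tangential
coordinates and one more direction. -/
theorem sum_norm_sq_normal_pos {k : ℕ} (hk : k ≤ n)
    {T : EuclideanSpace ℝ (Fin n) →L[ℝ] EuclideanSpace ℝ (Fin n)} (hT : Function.Injective T)
    (e : EuclideanSpace ℝ (Fin n)) {ξ : Fin (k + 2) → EuclideanSpace ℝ (Fin n)}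
    (hξ : LinearIndependent ℝ ξ) :
    0 < ∑ i, ‖normalProj n k (T (ξ i)) - inner ℝ e (normalProj n k (T (ξ i))) • e‖ ^ 2 := by
  by_contra! hle
  have hz : ∀ i, normalProj n k (T (ξ i)) = inner ℝ e (normalProj n k (T (ξ i))) • e := by
    intro i
    have h0 := (Finset.sum_eq_zero_iff_of_nonneg (fun i _ => by positivity)).1
      (le_antisymm hle (Finset.sum_nonneg fun i _ => by positivity)) i (Finset.mem_univ i)
    exact sub_eq_zero.1 (norm_eq_zero.1 (pow_eq_zero_iff (by norm_num) |>.1 h0))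
  set S : (Fin (k + 2) → ℝ) →ₗ[ℝ] EuclideanSpace ℝ (Fin n) :=
    Fintype.linearCombination ℝ ξ with hS
  -- The `k` tangential coordinates and the coefficient along `e` are `k + 1` linear conditions on
  -- `k + 2` unknowns. A nonzero solution has no tangential part, and by `hz` its normal part is a
  -- multiple of `e` with coefficient zero.
  set Λ : (Fin (k + 2) → ℝ) →ₗ[ℝ] (Fin k → ℝ) × ℝ :=
    (LinearMap.pi fun i : Fin k =>
      ((EuclideanSpace.proj (Fin.castLE hk i) : EuclideanSpace ℝ (Fin n) →L[ℝ] ℝ) :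
        EuclideanSpace ℝ (Fin n) →ₗ[ℝ] ℝ) ∘ₗ T.toLinearMap ∘ₗ S).prod
      ((innerSL ℝ e : EuclideanSpace ℝ (Fin n) →L[ℝ] ℝ).toLinearMap ∘ₗ
        (normalProj n k).toLinearMap ∘ₗ T.toLinearMap ∘ₗ S) with hΛ
  have hker : LinearMap.ker Λ ≠ ⊥ := LinearMap.ker_ne_bot_of_finrank_lt (by simp)
  obtain ⟨c, hc, hc0⟩ := (Submodule.ne_bot_iff _).1 hker
  have hc' : Λ c = 0 := hc
  have h1 : ∀ i : Fin k, T (S c) (Fin.castLE hk i) = 0 := fun i =>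
    congrFun (congrArg Prod.fst hc') i
  have h2 : inner ℝ e (normalProj n k (T (S c))) = (0 : ℝ) := congrArg Prod.snd hc'
  have h3 : normalProj n k (T (S c)) = inner ℝ e (normalProj n k (T (S c))) • e := by
    simp only [hS, Fintype.linearCombination_apply, map_sum, map_smul, inner_sum,
      inner_smul_right, Finset.sum_smul, mul_smul]
    exact Finset.sum_congr rfl fun i _ => by rw [← hz i]
  rw [h2, zero_smul, normalProj_eq_zero_iff] at h3
  have h4 : T (S c) = 0 := by
    ext i
    by_cases hi : k ≤ (i : ℕ)
    · simpa using h3 i hi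
    · simpa using h1 ⟨i, not_le.1 hi⟩
  have h5 : S c = 0 := hT (by rw [h4, map_zero])
  rw [hS, Fintype.linearCombination_apply] at h5
  exact hc0 (funext (Fintype.linearIndependent_iff.1 hξ c h5))

theorem isCompact_orthonormal (m : ℕ) :
    IsCompact {ξ : Fin m → EuclideanSpace ℝ (Fin n) | Orthonormal ℝ ξ} := by
  refine (isCompact_closedBall (0 : Fin m → EuclideanSpace ℝ (Fin n)) 1).of_isClosed_subset ?_ ?_
  · simp only [orthonormal_iff_ite, ofPred_forall]
    exact isClosed_iInter fun i => isClosed_iInter fun j => isClosed_eq (by fun_prop) (by fun_prop)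
  · intro ξ hξ
    rw [mem_closedBall_zero_iff, pi_norm_le_iff_of_nonneg zero_le_one]
    exact fun i => (hξ.1 i).le

/-- Uniform version of `sum_norm_sq_normal_pos` over a compact set of base points. -/
theorem exists_le_sum_norm_sq_normal {X : Type*} [TopologicalSpace X] {k : ℕ} (hk : k ≤ n)
    {K : Set X} (hK : IsCompact K)
    {T : X → EuclideanSpace ℝ (Fin n) →L[ℝ] EuclideanSpace ℝ (Fin n)} (hTc : ContinuousOn T K)
    (hT : ∀ x ∈ K, Function.Injective (T x)) :
    ∃ c : ℝ, 0 < c ∧ ∀ x ∈ K, ∀ e : EuclideanSpace ℝ (Fin n), ‖e‖ = 1 →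
      ∀ ξ : Fin (k + 2) → EuclideanSpace ℝ (Fin n), Orthonormal ℝ ξ →
        c ≤ ∑ i, ‖normalProj n k (T x (ξ i)) - inner ℝ e (normalProj n k (T x (ξ i))) • e‖ ^ 2 := by
  set G : (EuclideanSpace ℝ (Fin n) →L[ℝ] EuclideanSpace ℝ (Fin n)) ×
      EuclideanSpace ℝ (Fin n) × (Fin (k + 2) → EuclideanSpace ℝ (Fin n)) → ℝ := fun z =>
    ∑ i, ‖normalProj n k (z.1 (z.2.2 i)) -
      inner ℝ z.2.1 (normalProj n k (z.1 (z.2.2 i))) • z.2.1‖ ^ 2 with hG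
  have hT1 : ∀ i, Continuous fun z : (EuclideanSpace ℝ (Fin n) →L[ℝ] EuclideanSpace ℝ (Fin n)) ×
      EuclideanSpace ℝ (Fin n) × (Fin (k + 2) → EuclideanSpace ℝ (Fin n)) =>
      normalProj n k (z.1 (z.2.2 i)) := fun i =>
    (normalProj n k).continuous.comp (continuous_fst.clm_apply (by fun_prop))
  have he : Continuous fun z : (EuclideanSpace ℝ (Fin n) →L[ℝ] EuclideanSpace ℝ (Fin n)) ×
      EuclideanSpace ℝ (Fin n) × (Fin (k + 2) → EuclideanSpace ℝ (Fin n)) => z.2.1 := by fun_prop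
  have hin := fun i => he.inner (𝕜 := ℝ) (hT1 i)
  have hGc : Continuous G := continuous_finsetSum _ fun i _ => by
    exact ((hT1 i).sub ((hin i).smul he)).norm.pow 2
  obtain ⟨c, hc, h⟩ := ((hK.image_of_continuousOn hTc).prod
    ((isCompact_sphere (0 : EuclideanSpace ℝ (Fin n)) 1).prod
    (isCompact_orthonormal (n := n) (k + 2)))).exists_forall_le' hGc.continuousOn (a := 0) (by
      rintro ⟨_, e, ξ⟩ ⟨⟨x, hx, rfl⟩, -, hξ⟩
      exact sum_norm_sq_normal_pos hk (hT x hx) e hξ.linearIndependent)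
  exact ⟨c, hc, fun x hx e he ξ hξ => h (T x, e, ξ) ⟨⟨x, hx, rfl⟩, by simpa using he, hξ⟩⟩

end NormalProjection

/-- Some `ξ i` carries at least the average `c / m`. Pairing the form with the unit vector `y` along
its image, which is orthogonal to `e`, gives the rank-one minorant `b = A* y` by Cauchy–Schwarz. The
Hopf argument needs this single direction of large convexity. -/
theorem exists_vector_of_le_sum_norm_sq {V W : Type*} [NormedAddCommGroup V]
    [InnerProductSpace ℝ V] [CompleteSpace V] [NormedAddCommGroup W] [InnerProductSpace ℝ W]
    [CompleteSpace W] (A : V →L[ℝ] W) {e : W} (he : ‖e‖ = 1) {m : ℕ} [NeZero m] {ξ : Fin m → V}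
    (hξ : Orthonormal ℝ ξ) {c : ℝ} (hc0 : 0 < c)
    (hc : c ≤ ∑ i, ‖A (ξ i) - inner ℝ e (A (ξ i)) • e‖ ^ 2) :
    ∃ b : V, √(c / m) ≤ ‖b‖ ∧ ‖b‖ ≤ ‖A‖ ∧
      ∀ η : V, inner ℝ b η ^ 2 ≤ ‖A η - inner ℝ e (A η) • e‖ ^ 2 := by
  have hm : (0 : ℝ) < m := by exact_mod_cast Nat.pos_of_ne_zero (NeZero.ne m)
  obtain ⟨i, -, hi⟩ := Finset.exists_le_of_sum_le (s := Finset.univ) (f := fun _ : Fin m => c / m)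
    ⟨0, Finset.mem_univ _⟩ (by simpa [mul_div_cancel₀ c hm.ne'] using hc)
  set B : V → W := fun η => A η - inner ℝ e (A η) • e with hB
  have hBpos : 0 < ‖B (ξ i)‖ := by
    have h : 0 < ‖B (ξ i)‖ ^ 2 := lt_of_lt_of_le (by positivity) hi
    exact (norm_nonneg _).lt_of_ne fun h0 => by rw [← h0] at h; simp at h
  have hBe : ∀ η, inner ℝ (B η) e = 0 := fun η => by
    rw [hB]
    simp only
    rw [inner_sub_left, inner_smul_left, real_inner_self_eq_norm_sq, he, real_inner_comm]
    simp
  set y := ‖B (ξ i)‖⁻¹ • B (ξ i) with hy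
  have hy1 : ‖y‖ = 1 := by rw [hy, norm_smul, norm_inv, norm_norm, inv_mul_cancel₀ hBpos.ne']
  have hb : ∀ η, inner ℝ (ContinuousLinearMap.adjoint A y) η = inner ℝ y (B η) := by
    intro η
    rw [ContinuousLinearMap.adjoint_inner_left]
    simp only [hB, inner_sub_right, inner_smul_right]
    have : inner ℝ y e = 0 := by rw [hy, inner_smul_left, hBe, mul_zero]
    rw [this, mul_zero, sub_zero]
  refine ⟨ContinuousLinearMap.adjoint A y, ?_, ?_, fun η => ?_⟩
  · have h1 : inner ℝ (ContinuousLinearMap.adjoint A y) (ξ i) = ‖B (ξ i)‖ := by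
      rw [hb, hy, inner_smul_left, real_inner_self_eq_norm_sq, sq]
      simp [hBpos.ne']
    have h2 := real_inner_le_norm (ContinuousLinearMap.adjoint A y) (ξ i)
    rw [h1, hξ.1, mul_one] at h2
    exact (Real.sqrt_le_left (norm_nonneg _) |>.2 hi).trans h2
  · have h := (ContinuousLinearMap.adjoint A).le_opNorm y
    rwa [hy1, mul_one, LinearIsometryEquiv.norm_map] at h
  · rw [hb]
    have h := abs_real_inner_le_norm y (B η)
    rw [hy1, one_mul] at h
    exact sq_le_sq' (abs_le.1 h).1 (abs_le.1 h).2

/-- The inclusion of `ℝᵏ` as the first `k` coordinates of `ℝⁿ`. -/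
noncomputable def tangentialIncl (n k : ℕ) : (Fin k → ℝ) →L[ℝ] EuclideanSpace ℝ (Fin n) :=
  LinearMap.toContinuousLinearMap
    { toFun := fun w => WithLp.toLp 2 fun j : Fin n => if h : (j : ℕ) < k then w ⟨j, h⟩ else 0
      map_add' := fun w w' => by ext j; by_cases h : (j : ℕ) < k <;> simp [h]
      map_smul' := fun c w => by ext j; by_cases h : (j : ℕ) < k <;> simp [h] }

theorem tangentialIncl_apply {n k : ℕ} (w : Fin k → ℝ) (j : Fin n) :
    tangentialIncl n k w j = if h : (j : ℕ) < k then w ⟨j, h⟩ else 0 := rfl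

/-! ### Local parametrizations and defining functions -/

section LocalStructure

variable {n k : ℕ}

theorem IsSmoothClosedSubmanifold.exists_parametrization (hk : k ≤ n)
    {E : Set (EuclideanSpace ℝ (Fin n))} (hE : IsSmoothClosedSubmanifold k E)
    {x₀ : EuclideanSpace ℝ (Fin n)} (hx₀ : x₀ ∈ E) :
    ∃ (ψ : (Fin k → ℝ) → EuclideanSpace ℝ (Fin n)) (L : NNReal) (ρ : ℝ), 0 < ρ ∧
      LipschitzOnWith L ψ (Icc 0 3) ∧ (∀ w ∈ Icc (0 : Fin k → ℝ) 3, ψ w ∈ E) ∧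
      E ∩ Metric.closedBall x₀ ρ ⊆ ψ '' Icc 0 2 := by
  obtain ⟨Φ, hx₀s, hΦ, hΦs, hΦE⟩ := hE.2 x₀ hx₀
  set z₀ := Φ x₀ with hz₀
  have hz₀t : z₀ ∈ Φ.target := Φ.map_source hx₀s
  have hz₀0 : ∀ i : Fin n, k ≤ (i : ℕ) → z₀ i = 0 := (hΦE x₀ hx₀s).1 hx₀
  obtain ⟨K, t, ht, hK⟩ := ((hΦs.contDiffAt (Φ.open_target.mem_nhds hz₀t)).of_le
    (by norm_num : (1 : WithTop ℕ∞) ≤ ∞)).exists_lipschitzOnWith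
  obtain ⟨a, ha, hat⟩ := Metric.mem_nhds_iff.1 (inter_mem ht (Φ.open_target.mem_nhds hz₀t))
  set ι := tangentialIncl n k
  -- Centring at `w = 1`, the cube `[0, 3]ᵏ` has sup-radius `2`, so this scale keeps its image in
  -- the ball where `Φ.symm` is Lipschitz. Points of `E` with `‖Φ x - z₀‖ < α` then have parameters
  -- in `[0, 2]ᵏ`.
  set α : ℝ := a / (2 * ‖ι‖ + 1) with hα
  have hden : 0 < 2 * ‖ι‖ + 1 := by positivity
  have hα0 : 0 < α := by positivity
  set χ : (Fin k → ℝ) → EuclideanSpace ℝ (Fin n) := fun w => z₀ + α • ι (w - 1) with hχ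
  have hχmem : MapsTo χ (Icc 0 3) (t ∩ Φ.target) := by
    intro w hw
    apply hat
    rw [mem_ball_iff_norm]
    have h1 : ‖w - 1‖ ≤ 2 := by
      rw [pi_norm_le_iff_of_nonneg (by norm_num)]
      intro i
      have h2 := hw.1 i
      have h3 := hw.2 i
      simp only [Pi.ofNat_apply] at h2 h3
      rw [Pi.sub_apply, Pi.one_apply, Real.norm_eq_abs, abs_le]
      constructor <;> linarith
    have h4 : ‖ι (w - 1)‖ ≤ ‖ι‖ * 2 := ι.le_opNorm_of_le h1
    have h5 : χ w - z₀ = α • ι (w - 1) := by simp [hχ]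
    rw [h5, norm_smul, Real.norm_eq_abs, abs_of_pos hα0]
    calc α * ‖ι (w - 1)‖ ≤ α * (‖ι‖ * 2) := by gcongr
      _ < α * (2 * ‖ι‖ + 1) := by gcongr; linarith
      _ = a := by rw [hα]; field_simp
  have hχL : LipschitzWith (Real.toNNReal α * ‖ι‖₊) χ := by
    refine LipschitzWith.of_dist_le_mul fun w w' => ?_
    have : χ w - χ w' = α • ι (w - w') := by
      simp only [hχ, add_sub_add_left_eq_sub, ← smul_sub, ← map_sub, sub_sub_sub_cancel_right]
    rw [dist_eq_norm, this, norm_smul, Real.norm_eq_abs, abs_of_pos hα0, dist_eq_norm]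
    simp only [NNReal.coe_mul, Real.coe_toNNReal _ hα0.le, coe_nnnorm, mul_assoc]
    gcongr
    exact ι.le_opNorm _
  have hnear : ∀ᶠ x in 𝓝 x₀, x ∈ Φ.source ∧ ‖Φ x - z₀‖ < α := by
    filter_upwards [Φ.open_source.mem_nhds hx₀s,
      (Φ.continuousAt hx₀s).eventually (Metric.ball_mem_nhds z₀ hα0)] with x h1 h2
    exact ⟨h1, mem_ball_iff_norm.1 h2⟩
  obtain ⟨ρ, hρ, hρs⟩ := Metric.nhds_basis_closedBall.eventually_iff.1 hnear
  refine ⟨fun w => Φ.symm (χ w), K * (Real.toNNReal α * ‖ι‖₊), ρ, hρ,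
    hK.comp (hχL.lipschitzOnWith) fun w hw => (hχmem hw).1, fun w hw => ?_, ?_⟩
  · rw [hΦE _ (Φ.map_target (hχmem hw).2), Φ.right_inv (hχmem hw).2]
    intro i hi
    simp [hχ, hz₀0 i hi, ι, tangentialIncl_apply, not_lt.2 hi]
  · rintro x ⟨hxE, hxρ⟩
    obtain ⟨hxs, hxα⟩ := hρs hxρ
    have hx0 := (hΦE x hxs).1 hxE
    have hcoord : ∀ j : Fin n, |(Φ x - z₀) j| ≤ α := fun j =>
      (PiLp.norm_apply_le (Φ x - z₀) j).trans hxα.le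
    refine ⟨fun i => 1 + (Φ x - z₀) (Fin.castLE hk i) / α, ⟨fun i => ?_, fun i => ?_⟩, ?_⟩
    · have h1 := (abs_le.1 (hcoord (Fin.castLE hk i))).1
      have h2 : -1 ≤ (Φ x - z₀) (Fin.castLE hk i) / α := by rw [le_div_iff₀ hα0]; linarith
      simp only [Pi.zero_apply]; linarith
    · have h1 := (abs_le.1 (hcoord (Fin.castLE hk i))).2
      have h2 : (Φ x - z₀) (Fin.castLE hk i) / α ≤ 1 := by rw [div_le_iff₀ hα0]; linarith
      simp only [Pi.ofNat_apply]; linarith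
    · have : χ (fun i => 1 + (Φ x - z₀) (Fin.castLE hk i) / α) = Φ x := by
        ext j
        simp only [hχ, PiLp.add_apply, PiLp.smul_apply, ι, tangentialIncl_apply, smul_eq_mul]
        split_ifs with h
        · simp; field_simp; ring
        · simp [hx0 j (not_lt.1 h), hz₀0 j (not_lt.1 h)]
      simp only [this]
      exact Φ.left_inv hxs

/-- On the closed ball of radius `ρ` around `x₀`, the set `E` is the zero set of the function
`r ≥ 0`, which is `C²` off `E`, has bounded gradient, has a Hessian bounded below, and whose
Hessian has traces over orthonormal `(k + 2)`-frames of order at least `1 / r`. -/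
structure IsDefiningFunction (k : ℕ) (E : Set (EuclideanSpace ℝ (Fin n)))
    (x₀ : EuclideanSpace ℝ (Fin n)) (r : EuclideanSpace ℝ (Fin n) → ℝ) (ρ c C : ℝ) : Prop where
  radius_pos : 0 < ρ
  lower_pos : 0 < c
  upper_pos : 0 < C
  nonneg : ∀ x, 0 ≤ r x
  continuousOn : ContinuousOn r (Metric.closedBall x₀ ρ)
  eq_zero_iff : ∀ x ∈ Metric.closedBall x₀ ρ, r x = 0 ↔ x ∈ E
  regular : ∀ x ∈ Metric.closedBall x₀ ρ \ E, ContDiffAt ℝ 2 r x ∧ ‖fderiv ℝ r x‖ ≤ C ∧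
    (∀ ξ : Fin (k + 2) → EuclideanSpace ℝ (Fin n), Orthonormal ℝ ξ →
      c / r x - C ≤ ∑ i, secondDeriv r x (ξ i)) ∧
    ∃ b : EuclideanSpace ℝ (Fin n), c ≤ ‖b‖ ∧ ‖b‖ ≤ C ∧
      ∀ ξ, inner ℝ b ξ ^ 2 / r x - C * ‖ξ‖ ^ 2 ≤ secondDeriv r x ξ

/-- A closed submanifold of codimension at least two has local defining functions. -/
theorem IsSmoothClosedSubmanifold.exists_defining_function (hk : k + 2 ≤ n)
    {E : Set (EuclideanSpace ℝ (Fin n))} (hE : IsSmoothClosedSubmanifold k E)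
    {Ω : Set (EuclideanSpace ℝ (Fin n))} (hΩ : IsOpen Ω)
    {x₀ : EuclideanSpace ℝ (Fin n)} (hx₀ : x₀ ∈ E) (hx₀Ω : x₀ ∈ Ω) :
    ∃ (r : EuclideanSpace ℝ (Fin n) → ℝ) (ρ c C : ℝ), Metric.closedBall x₀ ρ ⊆ Ω ∧
      IsDefiningFunction k E x₀ r ρ c C := by
  obtain ⟨Φ, hx₀s, hΦ, hΦs, hΦE⟩ := hE.2 x₀ hx₀
  obtain ⟨ρ, hρ, hρs⟩ := Metric.nhds_basis_closedBall.mem_iff.1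
    (inter_mem (Φ.open_source.mem_nhds hx₀s) (hΩ.mem_nhds hx₀Ω))
  have hK := isCompact_closedBall x₀ ρ
  set K := Metric.closedBall x₀ ρ
  set f : EuclideanSpace ℝ (Fin n) → EuclideanSpace ℝ (Fin n) := fun x => normalProj n k (Φ x)
    with hf
  have hΦat : ∀ x ∈ Φ.source, ContDiffAt ℝ 2 Φ x := fun x hx =>
    (hΦ.contDiffAt (Φ.open_source.mem_nhds hx)).of_le ENat.LEInfty.out
  have hfat : ∀ x ∈ Φ.source, ContDiffAt ℝ 2 f x := fun x hx =>
    (normalProj n k).contDiff.contDiffAt.comp x (hΦat x hx)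
  have hfd : ∀ x ∈ Φ.source, fderiv ℝ f x = (normalProj n k).comp (fderiv ℝ Φ x) := fun x hx =>
    ((normalProj n k).hasFDerivAt.comp x
      ((hΦat x hx).differentiableAt (by norm_num)).hasFDerivAt).fderiv
  have hf0 : ∀ x ∈ Φ.source, f x = 0 ↔ x ∈ E := fun x hx => by
    rw [hΦE x hx]; exact normalProj_eq_zero_iff
  have hfc : ContDiffOn ℝ 2 f Φ.source := fun x hx => (hfat x hx).contDiffWithinAt
  have hKs : K ⊆ Φ.source := fun x hx => (hρs hx).1
  have hDf : ContinuousOn (fderiv ℝ f) K :=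
    (hfc.continuousOn_fderiv_of_isOpen Φ.open_source (by norm_num)).mono hKs
  have hDDf : ContinuousOn (fderiv ℝ (fderiv ℝ f)) K :=
    ((hfc.fderiv_of_isOpen (m := 1) Φ.open_source (by norm_num)).continuousOn_fderiv_of_isOpen
      Φ.open_source le_rfl).mono hKs
  have hDΦ : ContinuousOn (fderiv ℝ Φ) K :=
    (hΦ.continuousOn_fderiv_of_isOpen Φ.open_source (by norm_num)).mono hKs
  have hinj : ∀ x ∈ K, Function.Injective (fderiv ℝ Φ x) := by
    intro x hx
    have h1 : HasFDerivAt Φ.symm (fderiv ℝ Φ.symm (Φ x)) (Φ x) :=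
      ((hΦs.contDiffAt (Φ.open_target.mem_nhds (Φ.map_source (hKs hx)))).differentiableAt
        (by norm_num)).hasFDerivAt
    have h2 := h1.comp x ((hΦat x (hKs hx)).differentiableAt (by norm_num)).hasFDerivAt
    have h3 : HasFDerivAt (Φ.symm ∘ Φ) (ContinuousLinearMap.id ℝ _) x := by
      refine (hasFDerivAt_id x).congr_of_eventuallyEq ?_
      filter_upwards [Φ.open_source.mem_nhds (hKs hx)] with y hy
      exact Φ.left_inv hy
    have h4 := h2.unique h3
    refine Function.LeftInverse.injective (g := fderiv ℝ Φ.symm (Φ x)) fun v => ?_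
    exact congrArg (fun T : EuclideanSpace ℝ (Fin n) →L[ℝ] EuclideanSpace ℝ (Fin n) => T v) h4
  obtain ⟨c, hc, hcle⟩ := exists_le_sum_norm_sq_normal (by omega : k ≤ n) hK hDΦ hinj
  obtain ⟨C₁, hC₁⟩ := hK.exists_bound_of_continuousOn hDf
  obtain ⟨C₂, hC₂⟩ := hK.exists_bound_of_continuousOn
    (f := fderiv ℝ (fderiv ℝ f)) hDDf
  -- The factor `k + 2` absorbs the bounded Hessian error once it is summed over a frame.
  set C := max C₁ ((k + 2 : ℕ) * max C₂ 1) with hC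
  have hC2 : max C₂ 1 ≤ C := by
    refine le_trans ?_ (le_max_right _ _)
    have h1 : (1 : ℝ) ≤ (k + 2 : ℕ) := by exact_mod_cast (by omega : 1 ≤ k + 2)
    have h2 : 0 ≤ max C₂ 1 := zero_le_one.trans (le_max_right _ _)
    nlinarith
  have hCpos : 0 < C := lt_of_lt_of_le zero_lt_one ((le_max_right _ _).trans hC2)
  refine ⟨fun x => ‖f x‖, ρ, min c √(c / (k + 2 : ℕ)), C, fun x hx => (hρs hx).2, hρ, ?_, hCpos,
    fun x => norm_nonneg _, (hfc.continuousOn.mono hKs).norm, fun x hx => ?_, fun x hx => ?_⟩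
  · exact lt_min hc (Real.sqrt_pos.2 (by positivity))
  · rw [norm_eq_zero]; exact hf0 x (hKs hx)
  · have hxs := hKs hx.1
    have hx0 : f x ≠ 0 := fun h => hx.2 ((hf0 x hxs).1 h)
    have hr : 0 < ‖f x‖ := norm_pos_iff.2 hx0
    set e := ‖f x‖⁻¹ • f x with he
    have he1 : ‖e‖ = 1 := by rw [he, norm_smul, norm_inv, norm_norm, inv_mul_cancel₀ hr.ne']
    have hcx : ∀ ξ : Fin (k + 2) → EuclideanSpace ℝ (Fin n), Orthonormal ℝ ξ →
        c ≤ ∑ i, ‖fderiv ℝ f x (ξ i) - inner ℝ e (fderiv ℝ f x (ξ i)) • e‖ ^ 2 := by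
      intro ξ hξ
      have := hcle x hx.1 e he1 ξ hξ
      rw [hfd x hxs]
      exact this
    have hlow := secondDeriv_norm_comp_ge (hfat x hxs) hx0
    have hD2 : ‖fderiv ℝ (fderiv ℝ f) x‖ ≤ max C₂ 1 := (hC₂ x hx.1).trans (le_max_left _ _)
    refine ⟨(hfat x hxs).norm ℝ hx0, (norm_fderiv_norm_comp_le (hfat x hxs) hx0).trans
      ((hC₁ x hx.1).trans (le_max_left _ _)), fun ξ hξ => ?_, ?_⟩
    · have h1 := Finset.sum_le_sum fun i (_ : i ∈ Finset.univ) => hlow (ξ i)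
      refine le_trans ?_ h1
      rw [Finset.sum_sub_distrib, ← Finset.sum_div]
      simp only [hξ.1, one_pow, mul_one, Finset.sum_const, Finset.card_univ, Fintype.card_fin,
        nsmul_eq_mul]
      have h2 : ((k + 2 : ℕ) : ℝ) * ‖fderiv ℝ (fderiv ℝ f) x‖ ≤ C :=
        le_trans (by gcongr) (le_max_right _ _)
      have h3 : min c √(c / (k + 2 : ℕ)) / ‖f x‖ ≤
          (∑ i, ‖fderiv ℝ f x (ξ i) - inner ℝ e (fderiv ℝ f x (ξ i)) • e‖ ^ 2) / ‖f x‖ := by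
        gcongr
        exact (min_le_left _ _).trans (hcx ξ hξ)
      linarith
    · set s : Fin (k + 2) → EuclideanSpace ℝ (Fin n) := fun i =>
        EuclideanSpace.basisFun (Fin n) ℝ (Fin.castLE hk i)
      have hs : Orthonormal ℝ s :=
        (EuclideanSpace.basisFun (Fin n) ℝ).orthonormal.comp _ (Fin.castLE_injective hk)
      obtain ⟨b, hb1, hb2, hb3⟩ := exists_vector_of_le_sum_norm_sq _ he1 hs hc (hcx s hs)
      refine ⟨b, (min_le_right _ _).trans hb1, hb2.trans ((hC₁ x hx.1).trans (le_max_left _ _)),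
        fun ξ => le_trans ?_ (hlow ξ)⟩
      have h1 := hb3 ξ
      have h2 := hD2.trans hC2
      gcongr

end LocalStructure

/-! ### Monotonicity and local uniformity of elliptic operators -/

theorem Matrix.PosSemidef.exists_eq_conjTranspose_mul {n : ℕ} {N : Matrix (Fin n) (Fin n) ℝ}
    (hN : N.PosSemidef) : ∃ B : Matrix (Fin n) (Fin n) ℝ, N = B.conjTranspose * B := by
  refine ⟨Matrix.diagonal (fun i => √(hN.1.eigenvalues i)) *
    (hN.1.eigenvectorUnitary.1).conjTranspose, ?_⟩
  conv_lhs => rw [hN.1.spectral_theorem, Unitary.conjStarAlgAut_apply]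
  simp only [Matrix.conjTranspose_mul, Matrix.conjTranspose_conjTranspose,
    Matrix.diagonal_conjTranspose]
  simp only [Matrix.mul_assoc]
  congr 1
  rw [← Matrix.mul_assoc, Matrix.diagonal_mul_diagonal]
  congr 2
  funext i
  simp [Real.mul_self_sqrt (hN.eigenvalues_nonneg i)]

/-- Writing `N = B* B`, the sum is the trace of the positive semidefinite matrix `B G B*`. -/
theorem Matrix.PosSemidef.sum_mul_nonneg {n : ℕ} {G N : Matrix (Fin n) (Fin n) ℝ}
    (hG : G.PosSemidef) (hN : N.PosSemidef) : 0 ≤ ∑ i, ∑ j, G i j * N i j := by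
  obtain ⟨B, rfl⟩ := hN.exists_eq_conjTranspose_mul
  have h1 := (hG.mul_mul_conjTranspose_same B).trace_nonneg
  have h2 : ∑ i, ∑ j, G i j * (B.conjTranspose * B) i j = (B * G * B.conjTranspose).trace := by
    rw [Matrix.mul_assoc, Matrix.trace_mul_comm, Matrix.mul_assoc, Matrix.trace]
    simp only [Matrix.diag_apply, Matrix.mul_apply (M := G)]
    refine Finset.sum_congr rfl fun i _ => Finset.sum_congr rfl fun j _ => ?_
    have h3 := congrFun (congrFun (Matrix.isHermitian_conjTranspose_mul_self B) i) j
    rw [Matrix.conjTranspose_apply, star_trivial] at h3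
    rw [h3]
  rw [h2]; exact h1

section Elliptic

variable {n : ℕ}
  {F : EuclideanSpace ℝ (Fin n) × ℝ × EuclideanSpace ℝ (Fin n) × Matrix (Fin n) (Fin n) ℝ → ℝ}
  {Ω : Set (EuclideanSpace ℝ (Fin n))}

theorem Matrix.IsSymm.isHermitian_real {A : Matrix (Fin n) (Fin n) ℝ} (hA : A.IsSymm) :
    A.IsHermitian := by
  rw [Matrix.IsHermitian, Matrix.conjTranspose_eq_transpose_of_trivial]; exact hA

/-- An elliptic operator is nonincreasing in the Hessian variable. -/
theorem IsEllipticOn.antitone (hF : IsEllipticOn F Ω) {x : EuclideanSpace ℝ (Fin n)} (hx : x ∈ Ω)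
    (s : ℝ) (p : EuclideanSpace ℝ (Fin n)) {M M' : Matrix (Fin n) (Fin n) ℝ} (hM : M.IsSymm)
    (hM' : M'.IsSymm) (h : ∀ ξ : Fin n → ℝ, ξ ⬝ᵥ M.mulVec ξ ≤ ξ ⬝ᵥ M'.mulVec ξ) :
    F (x, s, p, M') ≤ F (x, s, p, M) := by
  set N := M' - M with hN
  have hNs : N.IsSymm := hM'.sub hM
  have hNp : N.PosSemidef := Matrix.PosSemidef.of_dotProduct_mulVec_nonneg hNs.isHermitian_real
    fun ξ => by
      rw [star_trivial, hN, Matrix.sub_mulVec, dotProduct_sub]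
      exact sub_nonneg.2 (h ξ)
  have hder : ∀ t : ℝ, ∃ D ≤ 0, HasDerivAt (fun t : ℝ => F (x, s, p, M + t • N)) D t := by
    intro t
    obtain ⟨G, ⟨-, hG⟩, hGp⟩ := hF x hx s p (M + t • N) (hM.add (hNs.smul t))
    have hG' := hG N hNs
    rw [← sub_self t] at hG'
    refine ⟨_, ?_, (hG'.comp_sub_const t t).congr_of_eventuallyEq
      (Eventually.of_forall fun τ => ?_)⟩
    · have := hGp.posSemidef.sum_mul_nonneg hNp
      simp only [Matrix.neg_apply, neg_mul, Finset.sum_neg_distrib] at this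
      linarith
    · simp only [add_assoc, ← add_smul, add_sub_cancel]
  have hanti : AntitoneOn (fun t : ℝ => F (x, s, p, M + t • N)) univ :=
    antitoneOn_of_deriv_nonpos convex_univ
      (fun t _ => (hder t).choose_spec.2.continuousAt.continuousWithinAt)
      (fun t _ => (hder t).choose_spec.2.differentiableAt.differentiableWithinAt)
      (fun t _ => by
        rw [(hder t).choose_spec.2.deriv]; exact (hder t).choose_spec.1)
  have := hanti (mem_univ 0) (mem_univ 1) zero_le_one
  simpa [hN] using this

/-- Uniform bounds for the derivative of an elliptic operator over bounded sets, in the directions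
used by barriers. -/
theorem IsEllipticOn.exists_uniform_bounds (hF : IsEllipticOn F Ω) (hΩ : IsOpen Ω)
    (hF1 : ContDiffOn ℝ 1 F (Ω ×ˢ univ ×ˢ univ ×ˢ {M | M.IsSymm}))
    {K : Set (EuclideanSpace ℝ (Fin n))} (hK : IsCompact K) (hKΩ : K ⊆ Ω) (R : ℝ) {c C : ℝ}
    (hc : 0 < c) :
    ∃ l L : ℝ, 0 < l ∧ 0 ≤ L ∧ ∀ x ∈ K, ∀ (s : ℝ) (p : EuclideanSpace ℝ (Fin n))
      (M : Matrix (Fin n) (Fin n) ℝ), |s| ≤ R → ‖p‖ ≤ R → ‖M‖ ≤ R → M.IsSymm →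
      ∀ (a : ℝ) (q b : EuclideanSpace ℝ (Fin n)) (κ μ : ℝ), 0 ≤ κ → 0 ≤ μ → c ≤ ‖b‖ → ‖b‖ ≤ C →
        ∃ D ≤ L * (|a| + ‖q‖ + μ) - κ * l,
          HasDerivAt (fun t : ℝ => F (x, s + t * a, p + t • q,
            M + t • (κ • Matrix.vecMulVec b.ofLp b.ofLp - μ • (1 : Matrix (Fin n) (Fin n) ℝ))))
            D 0 := by
  -- Composing with symmetrization extends `F` from symmetric matrices to a `C¹` function on an open
  -- set, so its ordinary derivative is continuous there.
  set S : Matrix (Fin n) (Fin n) ℝ →L[ℝ] Matrix (Fin n) (Fin n) ℝ := LinearMap.toContinuousLinearMap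
    ((1 / 2 : ℝ) • (LinearMap.id + (Matrix.transposeLinearEquiv (Fin n) (Fin n) ℝ ℝ).toLinearMap))
    with hS
  have hSapp : ∀ M, S M = (1 / 2 : ℝ) • (M + M.transpose) := fun M => rfl
  have hSsymm : ∀ M, (S M).IsSymm := fun M => by
    rw [hSapp, Matrix.IsSymm, Matrix.transpose_smul, Matrix.transpose_add,
      Matrix.transpose_transpose, add_comm]
  have hSfix : ∀ M : Matrix (Fin n) (Fin n) ℝ, M.IsSymm → S M = M := fun M hM => by
    rw [hSapp, hM.eq, ← two_smul ℝ M, smul_smul]; norm_num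
  set Ft : EuclideanSpace ℝ (Fin n) × ℝ × EuclideanSpace ℝ (Fin n) × Matrix (Fin n) (Fin n) ℝ → ℝ :=
    fun z => F (z.1, z.2.1, z.2.2.1, S z.2.2.2) with hFt
  set U : Set (EuclideanSpace ℝ (Fin n) × ℝ × EuclideanSpace ℝ (Fin n) ×
    Matrix (Fin n) (Fin n) ℝ) := Ω ×ˢ univ with hU
  have hUo : IsOpen U := hΩ.prod isOpen_univ
  have hFtc : ContDiffOn ℝ 1 Ft U := by
    refine hF1.comp (g := F) (f := fun z : EuclideanSpace ℝ (Fin n) × ℝ ×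
      EuclideanSpace ℝ (Fin n) × Matrix (Fin n) (Fin n) ℝ => (z.1, z.2.1, z.2.2.1, S z.2.2.2))
      (ContDiff.contDiffOn (by fun_prop)) fun z hz => ?_
    exact ⟨hz.1, mem_univ _, mem_univ _, hSsymm _⟩
  have hD := hFtc.continuousOn_fderiv_of_isOpen hUo le_rfl
  have hline : ∀ x ∈ Ω, ∀ (s : ℝ) (p : EuclideanSpace ℝ (Fin n)) (M : Matrix (Fin n) (Fin n) ℝ),
      M.IsSymm → ∀ (a : ℝ) (q : EuclideanSpace ℝ (Fin n)) (N : Matrix (Fin n) (Fin n) ℝ),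
      N.IsSymm → HasDerivAt (fun t : ℝ => F (x, s + t * a, p + t • q, M + t • N))
        (fderiv ℝ Ft (x, s, p, M) (0, a, q, N)) 0 := by
    intro x hx s p M hM a q N hN
    have hd : DifferentiableAt ℝ Ft (x, s, p, M) :=
      (hFtc.differentiableOn one_ne_zero).differentiableAt (hUo.mem_nhds ⟨hx, mem_univ _⟩)
    have h1 := hasDerivAt_comp_line (w := Ft) (x := (x, s, p, M)) (ξ := (0, a, q, N)) (t := 0)
      (by rw [zero_smul, add_zero]; exact hd)
    rw [zero_smul, add_zero] at h1
    refine h1.congr_of_eventuallyEq (Eventually.of_forall fun t => ?_)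
    simp [hFt, hSfix _ (hM.add (hN.smul t))]
  have hbb : ∀ b : EuclideanSpace ℝ (Fin n), (Matrix.vecMulVec b.ofLp b.ofLp).IsSymm := fun b => by
    ext i j; simp [Matrix.vecMulVec_apply, mul_comm]
  set T : Set (EuclideanSpace ℝ (Fin n) × ℝ × EuclideanSpace ℝ (Fin n) ×
    Matrix (Fin n) (Fin n) ℝ) := K ×ˢ Metric.closedBall 0 R ×ˢ Metric.closedBall 0 R ×ˢ
      (Metric.closedBall 0 R ∩ {M | M.IsSymm}) with hT
  have hsymc : IsClosed {M : Matrix (Fin n) (Fin n) ℝ | M.IsSymm} :=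
    isClosed_eq (by fun_prop) continuous_id
  have hTc : IsCompact T := hK.prod ((isCompact_closedBall 0 R).prod
    ((isCompact_closedBall 0 R).prod ((isCompact_closedBall 0 R).inter_right hsymc)))
  have hTU : T ⊆ U := fun z hz => ⟨hKΩ hz.1, mem_univ _⟩
  obtain ⟨L, hL⟩ := hTc.exists_bound_of_continuousOn (hD.mono hTU)
  set A : Set (EuclideanSpace ℝ (Fin n)) := Metric.closedBall 0 C ∩ {b | c ≤ ‖b‖} with hA
  have hAc : IsCompact A := (isCompact_closedBall 0 C).inter_right
    (isClosed_le continuous_const continuous_norm)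
  have hvec : Continuous fun b : EuclideanSpace ℝ (Fin n) =>
      ((0 : EuclideanSpace ℝ (Fin n)), (0 : ℝ), (0 : EuclideanSpace ℝ (Fin n)),
        Matrix.vecMulVec b.ofLp b.ofLp) := by
    refine continuous_const.prodMk (continuous_const.prodMk (continuous_const.prodMk ?_))
    exact continuous_matrix fun i j => by
      simp only [Matrix.vecMulVec_apply]; fun_prop
  -- Pointwise ellipticity becomes uniform on a compact set of arguments and of directions `b` with
  -- `c ≤ ‖b‖ ≤ C`.
  obtain ⟨l, hl, hle⟩ := (hTc.prod hAc).exists_forall_le' (a := 0)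
    (f := fun z => -(fderiv ℝ Ft z.1 (0, 0, 0, Matrix.vecMulVec z.2.ofLp z.2.ofLp))) (by
      refine ContinuousOn.neg (ContinuousOn.clm_apply ?_ ?_)
      · exact hD.comp continuousOn_fst fun z hz => hTU hz.1
      · exact hvec.comp_continuousOn continuousOn_snd) (by
      rintro ⟨⟨x, s, p, M⟩, b⟩ ⟨⟨hx, -, -, -, hM⟩, -, hb⟩
      obtain ⟨G, ⟨-, hG⟩, hGp⟩ := hF x (hKΩ hx) s p M hM
      have h1 := hline x (hKΩ hx) s p M hM 0 0 _ (hbb b)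
      simp only [mul_zero, add_zero, smul_zero] at h1
      have h2 := h1.unique (hG _ (hbb b))
      have hb0 : b.ofLp ≠ 0 := fun h0 => by
        have : b = 0 := by ext i; exact congrFun h0 i
        rw [mem_ofPred_eq, this, norm_zero] at hb
        linarith
      have h3 := hGp.dotProduct_mulVec_pos hb0
      have h4 : star b.ofLp ⬝ᵥ (-G).mulVec b.ofLp =
          -∑ i, ∑ j, G i j * Matrix.vecMulVec b.ofLp b.ofLp i j := by
        simp only [star_trivial, dotProduct, Matrix.mulVec, Finset.mul_sum,
          Matrix.vecMulVec_apply, Matrix.neg_apply, ← Finset.sum_neg_distrib]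
        refine Finset.sum_congr rfl fun i _ => Finset.sum_congr rfl fun j _ => ?_
        ring
      simp only
      rw [h2, ← h4]
      exact h3)
  refine ⟨l, max L 0, hl, le_max_right _ _, ?_⟩
  intro x hx s p M hs hp hM hMs a q b κ μ hκ hμ hcb hbC
  have hz : (x, s, p, M) ∈ T := ⟨hx, by simpa using hs, by simpa using hp, by simpa using hM, hMs⟩
  have hone : (1 : Matrix (Fin n) (Fin n) ℝ).IsSymm := Matrix.isSymm_one
  refine ⟨_, ?_, hline x (hKΩ hx) s p M hMs a q _ (((hbb b).smul κ).sub (hone.smul μ))⟩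
  have hsplit : ((0 : EuclideanSpace ℝ (Fin n)), a, q, κ • Matrix.vecMulVec b.ofLp b.ofLp -
      μ • (1 : Matrix (Fin n) (Fin n) ℝ)) = (0, a, q, -(μ • (1 : Matrix (Fin n) (Fin n) ℝ))) +
        κ • (0, 0, 0, Matrix.vecMulVec b.ofLp b.ofLp) := by
    simp [sub_eq_neg_add]
  rw [hsplit, map_add, map_smul, smul_eq_mul]
  have h1 : -(fderiv ℝ Ft (x, s, p, M) (0, 0, 0, Matrix.vecMulVec b.ofLp b.ofLp)) ≥ l :=
    hle ((x, s, p, M), b) ⟨hz, by simpa using hbC, hcb⟩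
  have h2 : ‖((0 : EuclideanSpace ℝ (Fin n)), a, q, -(μ • (1 : Matrix (Fin n) (Fin n) ℝ)))‖ ≤
      |a| + ‖q‖ + μ := by
    have h3 : ‖-(μ • (1 : Matrix (Fin n) (Fin n) ℝ))‖ ≤ μ := by
      rw [Matrix.norm_le_iff hμ]
      intro i j
      by_cases hij : i = j <;> simp [hij, abs_of_nonneg hμ, hμ]
    have h4 := norm_nonneg q
    have h5 := abs_nonneg a
    simp only [Prod.norm_def, norm_zero, Real.norm_eq_abs]
    refine max_le (by linarith) (max_le (by linarith) (max_le (by linarith) (by linarith)))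
  have h3 : fderiv ℝ Ft (x, s, p, M) (0, a, q, -(μ • (1 : Matrix (Fin n) (Fin n) ℝ))) ≤
      max L 0 * (|a| + ‖q‖ + μ) :=
    (le_abs_self _).trans (((fderiv ℝ Ft (x, s, p, M)).le_opNorm _).trans
      (mul_le_mul ((hL _ hz).trans (le_max_left _ _)) h2 (norm_nonneg _) (le_max_right _ _)))
  nlinarith

end Elliptic

/-! ### The Hopf-type linear bound -/

section SquaredDistance

variable {V : Type*} [NormedAddCommGroup V] [InnerProductSpace ℝ V]

theorem secondDeriv_norm_sub_sq (x₀ x ξ : V) :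
    secondDeriv (fun y => ‖y - x₀‖ ^ 2) x ξ = 2 * ‖ξ‖ ^ 2 := by
  have h := secondDeriv_radial (g := fun s => s) (g' := fun _ => 1) (g'' := fun _ => 0)
    (fun s _ => contDiffAt_id) (fun s _ => hasDerivAt_id s) (fun s _ => hasDerivAt_const s 1) x₀ x ξ
  simpa using h

theorem norm_fderiv_norm_sub_sq_le (x₀ x : V) :
    ‖fderiv ℝ (fun y => ‖y - x₀‖ ^ 2) x‖ ≤ 2 * ‖x - x₀‖ := by
  have h : HasFDerivAt (fun y => ‖y - x₀‖ ^ 2) (2 • (innerSL ℝ (x - x₀)).comp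
      (ContinuousLinearMap.id ℝ V)) x := ((hasFDerivAt_id x).sub_const x₀).norm_sq
  rw [h.fderiv, ContinuousLinearMap.comp_id]
  refine (norm_nsmul_le).trans ?_
  rw [innerSL_apply_norm]
  simp

end SquaredDistance

section LinearBound

variable {n k : ℕ}
  {F : EuclideanSpace ℝ (Fin n) × ℝ × EuclideanSpace ℝ (Fin n) × Matrix (Fin n) (Fin n) ℝ → ℝ}
  {Ω E : Set (EuclideanSpace ℝ (Fin n))} {x₀ : EuclideanSpace ℝ (Fin n)}
  {r u v : EuclideanSpace ℝ (Fin n) → ℝ} {ρ c C : ℝ}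

theorem norm_gradient (w : EuclideanSpace ℝ (Fin n) → ℝ) (x : EuclideanSpace ℝ (Fin n)) :
    ‖gradient w x‖ = ‖fderiv ℝ w x‖ := by
  rw [gradient, LinearIsometryEquiv.norm_map]

theorem continuousOn_hessian {w : EuclideanSpace ℝ (Fin n) → ℝ} (hΩ : IsOpen Ω)
    (hw : ContDiffOn ℝ 2 w Ω) : ContinuousOn (hessian w) Ω := by
  have h1 : ContinuousOn (fderiv ℝ (fderiv ℝ w)) Ω :=
    (hw.fderiv_of_isOpen (m := 1) hΩ (by norm_num)).continuousOn_fderiv_of_isOpen hΩ le_rfl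
  refine continuousOn_pi.2 fun i => continuousOn_pi.2 fun j => ?_
  have h2 : ContinuousOn (fun x => fderiv ℝ (fderiv ℝ w) x (EuclideanSpace.single i (1 : ℝ))
      (EuclideanSpace.single j (1 : ℝ))) Ω :=
    (h1.clm_apply continuousOn_const).clm_apply continuousOn_const
  exact h2.congr fun x hx => hessian_apply (hw.contDiffAt (hΩ.mem_nhds hx)) i j

/-- Monotonicity along a segment. The derivative is taken at parameter `0` from each intermediate
point, the form in which the uniform bounds supply it. -/
theorem IsEllipticOn.lt_of_hasDerivAt_neg {x : EuclideanSpace ℝ (Fin n)} {s a : ℝ}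
    {p q : EuclideanSpace ℝ (Fin n)} {M N : Matrix (Fin n) (Fin n) ℝ}
    (h : ∀ θ ∈ Icc (0 : ℝ) 1, ∃ D < 0, HasDerivAt (fun t : ℝ =>
      F (x, (s + θ * a) + t * a, (p + θ • q) + t • q, (M + θ • N) + t • N)) D 0) :
    F (x, s + a, p + q, M + N) < F (x, s, p, M) := by
  set φ : ℝ → ℝ := fun t => F (x, s + t * a, p + t • q, M + t • N) with hφ
  have hder : ∀ θ ∈ Icc (0 : ℝ) 1, ∃ D < 0, HasDerivAt φ D θ := by
    intro θ hθ
    obtain ⟨D, hD, hDer⟩ := h θ hθ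
    rw [← sub_self θ] at hDer
    refine ⟨D, hD, (hDer.comp_sub_const θ θ).congr_of_eventuallyEq
      (Eventually.of_forall fun τ => ?_)⟩
    simp only [hφ, add_assoc, ← add_smul, ← add_mul, add_sub_cancel]
  have hanti : StrictAntiOn φ (Icc 0 1) := strictAntiOn_of_deriv_neg (convex_Icc 0 1)
    (fun t ht => by
      obtain ⟨D, -, hD⟩ := hder t ht
      exact hD.continuousAt.continuousWithinAt)
    (fun t ht => by
      obtain ⟨D, hD0, hD⟩ := hder t (interior_subset ht)
      rw [hD.deriv]; exact hD0)
  have := hanti (left_mem_Icc.2 zero_le_one) (right_mem_Icc.2 zero_le_one) zero_lt_one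
  simpa [hφ] using this

theorem rankOne_quadratic (b ξ : EuclideanSpace ℝ (Fin n)) (κ μ : ℝ) :
    ξ.ofLp ⬝ᵥ (κ • Matrix.vecMulVec b.ofLp b.ofLp - μ • (1 : Matrix (Fin n) (Fin n) ℝ)).mulVec
      ξ.ofLp = κ * inner ℝ b ξ ^ 2 - μ * ‖ξ‖ ^ 2 := by
  have h1 : ξ.ofLp ⬝ᵥ ξ.ofLp = ‖ξ‖ ^ 2 := by
    rw [EuclideanSpace.real_norm_sq_eq]
    exact Finset.sum_congr rfl fun i _ => (sq _).symm
  have h2 : inner ℝ b ξ = ξ.ofLp ⬝ᵥ b.ofLp := by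
    simp [EuclideanSpace.inner_eq_star_dotProduct]
  rw [Matrix.sub_mulVec, Matrix.smul_mulVec, Matrix.smul_mulVec, Matrix.one_mulVec,
    Matrix.vecMulVec_mulVec, dotProduct_sub]
  simp only [dotProduct_smul, h1, h2, op_smul_eq_mul, smul_eq_mul, dotProduct_comm b.ofLp]
  ring

theorem norm_rankOne_le {b : EuclideanSpace ℝ (Fin n)} (hb : ‖b‖ ≤ C) {κ μ : ℝ} (hκ : 0 ≤ κ)
    (hμ : 0 ≤ μ) : ‖κ • Matrix.vecMulVec b.ofLp b.ofLp - μ • (1 : Matrix (Fin n) (Fin n) ℝ)‖ ≤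
      κ * C ^ 2 + μ := by
  rw [Matrix.norm_le_iff (by positivity)]
  intro i j
  have h1 : ∀ i, |b i| ≤ C := fun i => (PiLp.norm_apply_le b i).trans hb
  have h2 : |b i * b j| ≤ C ^ 2 := by
    rw [abs_mul, sq]
    exact mul_le_mul (h1 i) (h1 j) (abs_nonneg _) ((abs_nonneg _).trans (h1 i))
  have h3 : |(1 : Matrix (Fin n) (Fin n) ℝ) i j| ≤ 1 := by
    rw [Matrix.one_apply]
    split_ifs <;> simp
  have h4 : (κ • Matrix.vecMulVec b.ofLp b.ofLp - μ • (1 : Matrix (Fin n) (Fin n) ℝ)) i j =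
      κ * (b i * b j) - μ * (1 : Matrix (Fin n) (Fin n) ℝ) i j := rfl
  rw [h4, Real.norm_eq_abs]
  refine (abs_sub _ _).trans ?_
  rw [abs_mul κ, abs_mul μ, abs_of_nonneg hκ, abs_of_nonneg hμ]
  nlinarith [mul_le_mul_of_nonneg_left h2 hκ, mul_le_mul_of_nonneg_left h3 hμ]

theorem gradient_eq_of_fderiv_eq {u w : EuclideanSpace ℝ (Fin n) → ℝ}
    {x : EuclideanSpace ℝ (Fin n)} : gradient u x - gradient w x =
      (InnerProductSpace.toDual ℝ _).symm (fderiv ℝ u x - fderiv ℝ w x) := by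
  simp [gradient]

set_option maxHeartbeats 1000000 in
/-- A quantitative Hopf-type bound at a submanifold of codimension at least two: the difference of
a supersolution and a subsolution grows at least linearly in the distance to `E`. -/
theorem IsDefiningFunction.exists_linear_lower_bound (hr : IsDefiningFunction k E x₀ r ρ c C)
    (hx₀ : x₀ ∈ E) (hE : IsClosed E) (hΩ : IsOpen Ω) (hball : Metric.closedBall x₀ ρ ⊆ Ω)
    (hF : ContDiffOn ℝ 1 F (Ω ×ˢ univ ×ˢ univ ×ˢ {M | M.IsSymm})) (hell : IsEllipticOn F Ω)
    (hu : ContDiffOn ℝ 2 u (Ω \ E)) (hv : ContDiffOn ℝ 2 v Ω)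
    (huv : ∀ x ∈ Ω \ E, v x < u x)
    (hFuv : ∀ x ∈ Ω \ E,
      F (x, v x, gradient v x, hessian v x) ≤ F (x, u x, gradient u x, hessian u x)) :
    ∃ η ρ' : ℝ, 0 < η ∧ 0 < ρ' ∧ ρ' ≤ ρ ∧
      ∀ x ∈ Metric.closedBall x₀ ρ' \ E, η * (r x - ‖x - x₀‖ ^ 2) ≤ u x - v x := by
  have hΩE : IsOpen (Ω \ E) := hΩ.sdiff hE
  have hK := isCompact_closedBall x₀ ρ
  have hC := hr.upper_pos
  have hρ := hr.radius_pos
  obtain ⟨R₁, hR₁⟩ := hK.exists_bound_of_continuousOn (hv.continuousOn.mono hball)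
  obtain ⟨R₂, hR₂⟩ := hK.exists_bound_of_continuousOn
    ((hv.continuousOn_fderiv_of_isOpen hΩ (by norm_num)).mono hball)
  obtain ⟨R₃, hR₃⟩ := hK.exists_bound_of_continuousOn ((continuousOn_hessian hΩ hv).mono hball)
  set R := max R₁ (max R₂ R₃) with hR
  have hRR₁ : R₁ ≤ R := le_max_left _ _
  have hRR₂ : R₂ ≤ R := (le_max_left _ _).trans (le_max_right _ _)
  have hRR₃ : R₃ ≤ R := (le_max_right _ _).trans (le_max_right _ _)
  obtain ⟨l, L, hl, hL, hbound⟩ := hell.exists_uniform_bounds hΩ hF hK hball (R + 1)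
    (C := C) hr.lower_pos
  -- Chosen so that the rank-one gain `κ l` beats the zeroth-order, gradient and identity terms by
  -- `1`. It does not depend on `η`, so `η` may be shrunk afterwards.
  set κ : ℝ := (L * (1 + (C + 2 * ρ) + (C + 2)) + 1) / l with hκ
  have hκ0 : 0 < κ := by positivity
  have hκl : κ * l = L * (1 + (C + 2 * ρ) + (C + 2)) + 1 := by rw [hκ]; field_simp
  obtain ⟨ρ', hρ', hρ'ρ, hrsmall⟩ : ∃ ρ' : ℝ, 0 < ρ' ∧ ρ' ≤ ρ ∧
      ∀ x ∈ Metric.closedBall x₀ ρ', r x < min 1 κ⁻¹ := by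
    have h0 : r x₀ = 0 := (hr.eq_zero_iff x₀ (Metric.mem_closedBall_self hρ.le)).2 hx₀
    have hca : ContinuousAt r x₀ :=
      hr.continuousOn.continuousAt (Metric.closedBall_mem_nhds x₀ hρ)
    have hev : ∀ᶠ x in 𝓝 x₀, r x < min 1 κ⁻¹ :=
      hca.eventually (gt_mem_nhds (by rw [h0]; positivity))
    obtain ⟨σ, hσ, hσs⟩ := Metric.nhds_basis_closedBall.eventually_iff.1 hev
    exact ⟨min σ ρ, lt_min hσ hρ, min_le_right _ _, fun x hx =>
      hσs (Metric.closedBall_subset_closedBall (min_le_left _ _) hx)⟩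
  have hsub : Metric.closedBall x₀ ρ' ⊆ Metric.closedBall x₀ ρ :=
    Metric.closedBall_subset_closedBall hρ'ρ
  have hsubΩ : Metric.closedBall x₀ ρ' \ E ⊆ Ω \ E := fun x hx => ⟨hball (hsub hx.1), hx.2⟩
  obtain ⟨m, hm, hmle⟩ : ∃ m : ℝ, 0 < m ∧
      ∀ x ∈ Metric.sphere x₀ ρ' ∩ {x | ρ' ^ 2 ≤ r x}, m ≤ u x - v x := by
    have hrs : ContinuousOn r (Metric.sphere x₀ ρ') :=
      hr.continuousOn.mono (Metric.sphere_subset_closedBall.trans hsub)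
    have hSc : IsCompact (Metric.sphere x₀ ρ' ∩ {x | ρ' ^ 2 ≤ r x}) :=
      (isCompact_sphere x₀ ρ').of_isClosed_subset
        (hrs.preimage_isClosed_of_isClosed Metric.isClosed_sphere isClosed_Ici) inter_subset_left
    have hSsub : Metric.sphere x₀ ρ' ∩ {x | ρ' ^ 2 ≤ r x} ⊆ Ω \ E := by
      rintro x ⟨hx, hxr⟩
      have hxK := hsub (Metric.sphere_subset_closedBall hx)
      refine ⟨hball hxK, fun hxE => ?_⟩
      have h0 := (hr.eq_zero_iff x hxK).2 hxE
      have : ρ' ^ 2 ≤ r x := hxr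
      have : 0 < ρ' ^ 2 := by positivity
      linarith
    exact hSc.exists_forall_le' ((hu.continuousOn.mono hSsub).sub
      (hv.continuousOn.mono fun x hx => (hSsub hx).1)) fun x hx => sub_pos.2 (huv x (hSsub hx))
  -- `η Q` bounds the total change of value, gradient and Hessian; `η Q ≤ 1` keeps the arguments in
  -- the set of size `R + 1` where the bounds hold. `η ≤ m` handles the part of the sphere where `r
  -- ≥ ρ'²`; elsewhere on it the barrier is nonpositive.
  set Q : ℝ := 1 + (C + 2 * ρ) + (κ * C ^ 2 + (C + 2)) with hQ
  have hQ0 : 0 < Q := by positivity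
  set η : ℝ := min m Q⁻¹ with hη
  have hη0 : 0 < η := lt_min hm (inv_pos.2 hQ0)
  have hηm : η ≤ m := min_le_left _ _
  have hηQ : η * Q ≤ 1 := by
    calc η * Q ≤ Q⁻¹ * Q := by gcongr; exact min_le_right _ _
      _ = 1 := inv_mul_cancel₀ hQ0.ne'
  refine ⟨η, ρ', hη0, hρ', hρ'ρ, fun y hy => ?_⟩
  by_contra! hlt
  set h : EuclideanSpace ℝ (Fin n) → ℝ := fun x => η * (r x - ‖x - x₀‖ ^ 2) with hh
  have hsqc : ContDiff ℝ 2 fun x : EuclideanSpace ℝ (Fin n) => ‖x - x₀‖ ^ 2 :=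
    (contDiff_id.sub contDiff_const).norm_sq ℝ
  have hhc : ContinuousOn h (Metric.closedBall x₀ ρ') :=
    continuousOn_const.mul ((hr.continuousOn.mono hsub).sub hsqc.continuous.continuousOn)
  have hvc : ContinuousOn v (Metric.closedBall x₀ ρ') := hv.continuousOn.mono (hsub.trans hball)
  obtain ⟨x, hx, hmax, hpos⟩ := exists_isLocalMax_of_pos hE (x₀ := x₀) (ρ := ρ')
    (g := fun x => h x - (u x - v x)) (ψ := h)
    ((hhc.mono sdiff_subset).sub ((hu.continuousOn.mono hsubΩ).sub (hvc.mono sdiff_subset)))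
    hhc (fun x hx => by linarith [huv x (hsubΩ hx)])
    (fun x hx => by
      have h0 := (hr.eq_zero_iff x (hsub hx.1)).2 hx.2
      simp only [hh, h0]
      nlinarith [sq_nonneg ‖x - x₀‖])
    (fun x hx => by
      have hxs := Metric.sphere_subset_closedBall hx.1
      have hdist : ‖x - x₀‖ = ρ' := by simpa [dist_eq_norm] using hx.1
      have huvx := huv x (hsubΩ ⟨hxs, hx.2⟩)
      have hr1 := (hrsmall x hxs).le.trans (min_le_left _ _)
      simp only [hh, hdist]
      rcases le_total (ρ' ^ 2) (r x) with hcase | hcase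
      · have := hmle x ⟨hx.1, hcase⟩
        nlinarith [sq_nonneg ρ']
      · nlinarith)
    hy (by simp only [hh]; linarith)
  have hxc : x ∈ Metric.closedBall x₀ ρ' := Metric.ball_subset_closedBall hx.1
  have hxK := hsub hxc
  have hxΩ : x ∈ Ω \ E := hsubΩ ⟨hxc, hx.2⟩
  obtain ⟨hrc, hr1, -, b, hcb, hbC, hrlow⟩ := hr.regular x ⟨hxK, hx.2⟩
  have huc : ContDiffAt ℝ 2 u x := hu.contDiffAt (hΩE.mem_nhds hxΩ)
  have hvc' : ContDiffAt ℝ 2 v x := hv.contDiffAt (hΩ.mem_nhds hxΩ.1)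
  have hhat : ContDiffAt ℝ 2 h x := contDiffAt_const.mul (hrc.sub hsqc.contDiffAt)
  have hrpos : 0 < r x := lt_of_le_of_ne (hr.nonneg x) fun h0 =>
    hx.2 ((hr.eq_zero_iff x hxK).1 h0.symm)
  have hrx := hrsmall x hxc
  have hr_le : r x ≤ 1 := hrx.le.trans (min_le_left _ _)
  have hκr : κ ≤ 1 / r x := by
    rw [le_div_iff₀ hrpos]
    calc κ * r x ≤ κ * κ⁻¹ := by gcongr; exact hrx.le.trans (min_le_right _ _)
      _ = 1 := mul_inv_cancel₀ hκ0.ne'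
  have hdistρ : ‖x - x₀‖ ≤ ρ := by simpa [dist_eq_norm] using hxK
  -- A lower bound for the Hessian of the barrier, with `1 / r` weakened to the constant `κ` so that
  -- `N` stays bounded near `E`. The extra `2` comes from `‖x - x₀‖²`.
  set N : Matrix (Fin n) (Fin n) ℝ := (η * κ) • Matrix.vecMulVec b.ofLp b.ofLp -
    (η * (C + 2)) • (1 : Matrix (Fin n) (Fin n) ℝ) with hN
  have hNs : N.IsSymm := by
    refine Matrix.IsSymm.sub (Matrix.IsSymm.smul ?_ _) (Matrix.isSymm_one.smul _)
    ext i j; simp [Matrix.vecMulVec_apply, mul_comm]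
  set a : ℝ := u x - v x with ha
  set q : EuclideanSpace ℝ (Fin n) := gradient u x - gradient v x with hq
  have ha0 : 0 < a := sub_pos.2 (huv x hxΩ)
  have haη : a ≤ η := by
    have h1 : a ≤ h x := by linarith
    have h2 : h x ≤ η := by simp only [hh]; nlinarith [sq_nonneg ‖x - x₀‖]
    linarith
  have hqη : ‖q‖ ≤ η * (C + 2 * ρ) := by
    have hd0 := hmax.fderiv_eq_zero
    have hdu := huc.differentiableAt (by norm_num)
    have hdv := hvc'.differentiableAt (by norm_num)
    have hdh := hhat.differentiableAt (by norm_num)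
    rw [fderiv_fun_sub hdh (hdu.fun_sub hdv), fderiv_fun_sub hdu hdv] at hd0
    have hdr : DifferentiableAt ℝ r x := hrc.differentiableAt (by norm_num)
    have hds : DifferentiableAt ℝ (fun x => ‖x - x₀‖ ^ 2) x :=
      hsqc.contDiffAt.differentiableAt (by norm_num)
    have hfd : fderiv ℝ h x = η • (fderiv ℝ r x - fderiv ℝ (fun x => ‖x - x₀‖ ^ 2) x) := by
      rw [hh, fderiv_const_mul (hdr.fun_sub hds), fderiv_fun_sub hdr hds]
    rw [hq, gradient_eq_of_fderiv_eq, LinearIsometryEquiv.norm_map, ← sub_eq_zero.1 hd0, hfd,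
      norm_smul, Real.norm_eq_abs, abs_of_pos hη0]
    gcongr
    refine (norm_sub_le _ _).trans (add_le_add hr1 ((norm_fderiv_norm_sub_sq_le x₀ x).trans ?_))
    gcongr
  have hNnorm : ‖N‖ ≤ η * (κ * C ^ 2 + (C + 2)) := by
    refine (norm_rankOne_le hbC (by positivity) (by positivity)).trans (le_of_eq ?_)
    ring
  have hρ0 := hρ.le
  have hηQ' : η * 1 + η * (C + 2 * ρ) + η * (κ * C ^ 2 + (C + 2)) ≤ 1 := by
    rw [hQ] at hηQ; linarith
  have hnn1 : 0 ≤ η * (C + 2 * ρ) := by positivity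
  have hnn2 : 0 ≤ η * (κ * C ^ 2 + (C + 2)) := by positivity
  have hlt : F (x, v x + a, gradient v x + q, hessian v x + N) <
      F (x, v x, gradient v x, hessian v x) := by
    refine IsEllipticOn.lt_of_hasDerivAt_neg fun θ hθ => ?_
    have hθ1 : |θ| ≤ 1 := abs_le.2 ⟨by linarith [hθ.1], hθ.2⟩
    have hb1 : |v x + θ * a| ≤ R + 1 := by
      refine (abs_add_le _ _).trans (add_le_add ((hR₁ x hxK).trans hRR₁) ?_)
      rw [abs_mul, abs_of_pos ha0]
      exact mul_le_one₀ hθ1 ha0.le (by linarith)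
    have hb2 : ‖gradient v x + θ • q‖ ≤ R + 1 := by
      refine (norm_add_le _ _).trans (add_le_add ?_ ?_)
      · rw [norm_gradient]; exact (hR₂ x hxK).trans hRR₂
      · rw [norm_smul, Real.norm_eq_abs]
        exact mul_le_one₀ hθ1 (norm_nonneg _) (by linarith)
    have hb3 : ‖hessian v x + θ • N‖ ≤ R + 1 := by
      refine (norm_add_le _ _).trans (add_le_add ((hR₃ x hxK).trans hRR₃) ?_)
      rw [norm_smul, Real.norm_eq_abs]
      exact mul_le_one₀ hθ1 (norm_nonneg _) (by linarith)
    obtain ⟨D, hD, hDer⟩ := hbound x hxK _ _ _ hb1 hb2 hb3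
      ((hessian_isSymm hvc').add (hNs.smul θ)) a q b (η * κ)
      (η * (C + 2)) (by positivity) (by positivity) hcb hbC
    refine ⟨D, lt_of_le_of_lt hD ?_, hDer⟩
    rw [abs_of_pos ha0]
    have h1 : L * (a + ‖q‖ + η * (C + 2)) ≤ L * (η * (1 + (C + 2 * ρ) + (C + 2))) := by
      gcongr
      linarith
    have h2 : η * κ * l = η * (L * (1 + (C + 2 * ρ) + (C + 2)) + 1) := by
      rw [mul_assoc, hκl]
    rw [h2]
    linarith
  -- The Hessian of `u` has no bound near `E`, so monotonicity first replaces it by the smaller,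
  -- bounded matrix `hessian v x + N`.
  have hmono : F (x, u x, gradient u x, hessian u x) ≤
      F (x, u x, gradient u x, hessian v x + N) := by
    refine hell.antitone hxΩ.1 _ _ ((hessian_isSymm hvc').add hNs) (hessian_isSymm huc) fun ξ' => ?_
    set ξ : EuclideanSpace ℝ (Fin n) := WithLp.toLp 2 ξ' with hξ
    have hξ' : ξ' = ξ.ofLp := rfl
    rw [hξ', Matrix.add_mulVec, dotProduct_add, hessian_quadratic huc, hessian_quadratic hvc',
      hN, rankOne_quadratic]
    have h1 := hmax.secondDeriv_nonpos (hhat.sub (huc.sub hvc')) ξ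
    rw [secondDeriv_sub hhat (huc.sub hvc'), secondDeriv_sub huc hvc',
      secondDeriv_const_mul (hrc.sub hsqc.contDiffAt), secondDeriv_sub hrc hsqc.contDiffAt,
      secondDeriv_norm_sub_sq] at h1
    have h2 := hrlow ξ
    have h3 : κ * inner ℝ b ξ ^ 2 ≤ inner ℝ b ξ ^ 2 / r x := by
      rw [div_eq_mul_one_div, mul_comm]
      gcongr
    have h4 : η * (κ * inner ℝ b ξ ^ 2 - (C + 2) * ‖ξ‖ ^ 2) ≤
        η * (secondDeriv r x ξ - 2 * ‖ξ‖ ^ 2) :=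
      mul_le_mul_of_nonneg_left (by linarith) hη0.le
    linarith
  have hend : F (x, u x, gradient u x, hessian v x + N) =
      F (x, v x + a, gradient v x + q, hessian v x + N) := by
    rw [ha, hq, add_sub_cancel, add_sub_cancel]
  have := hFuv x hxΩ
  linarith

end LinearBound

/-! ### From the linear bound to a positive bound -/

section PositiveBound

variable {n k : ℕ}
  {F : EuclideanSpace ℝ (Fin n) × ℝ × EuclideanSpace ℝ (Fin n) × Matrix (Fin n) (Fin n) ℝ → ℝ}
  {Ω E : Set (EuclideanSpace ℝ (Fin n))} {x₀ : EuclideanSpace ℝ (Fin n)}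
  {r u v : EuclideanSpace ℝ (Fin n) → ℝ} {ρ c C : ℝ}

set_option maxHeartbeats 1000000 in
/-- A linear lower bound for `u - v` improves to a positive lower bound near `E`, if `E` is polar
and the sum of the `k + 2` smallest eigenvalues of the Hessian of `u` is nonpositive. -/
theorem IsDefiningFunction.exists_pos_lower_bound (hk : k + 2 ≤ n)
    (hr : IsDefiningFunction k E x₀ r ρ c C)
    (hx₀ : x₀ ∈ E) (hE : IsClosed E) (hΩ : IsOpen Ω) (hball : Metric.closedBall x₀ ρ ⊆ Ω)
    {ψ : (Fin k → ℝ) → EuclideanSpace ℝ (Fin n)} {L : NNReal}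
    (hψ : LipschitzOnWith L ψ (Icc 0 3)) (hψE : ∀ w ∈ Icc (0 : Fin k → ℝ) 3, ψ w ∈ E)
    (hEψ : E ∩ Metric.closedBall x₀ ρ ⊆ ψ '' Icc 0 2)
    (hu : ContDiffOn ℝ 2 u (Ω \ E)) (hv : ContDiffOn ℝ 2 v Ω)
    (hlam : ∀ x ∈ Ω \ E, ∑ i ∈ Finset.range (k + 2), orderedEigenvalue (hessian u x) i ≤ 0)
    (huv : ∀ x ∈ Ω \ E, v x < u x) {η : ℝ} (hη : 0 < η)
    (hlin : ∀ x ∈ Metric.closedBall x₀ ρ \ E, η * (r x - ‖x - x₀‖ ^ 2) ≤ u x - v x) :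
    ∃ δ : ℝ, 0 < δ ∧ ∀ᶠ x in 𝓝 x₀, x ∉ E → δ ≤ u x - v x := by
  have hΩE : IsOpen (Ω \ E) := hΩ.sdiff hE
  have hC := hr.upper_pos
  have hc := hr.lower_pos
  have hρ := hr.radius_pos
  obtain ⟨A, hA⟩ := (isCompact_closedBall x₀ ρ).exists_bound_of_continuousOn
    (f := fderiv ℝ (fderiv ℝ v)) (((hv.fderiv_of_isOpen (m := 1) hΩ
      (by norm_num)).continuousOn_fderiv_of_isOpen hΩ le_rfl).mono hball)
  -- Collects the bounded trace terms: those of `v`, of the error in `r`, and of `2‖x - x₀‖²`. The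
  -- radius is then shrunk until `η c / r` exceeds `B`.
  set B : ℝ := (k + 2 : ℕ) * |A| + η * C + 4 * η * (k + 2 : ℕ) with hB
  have hB0 : 0 < B := by positivity
  obtain ⟨ρ', hρ', hρ'ρ, hrsmall⟩ : ∃ ρ' : ℝ, 0 < ρ' ∧ ρ' ≤ ρ ∧
      ∀ x ∈ Metric.closedBall x₀ ρ', r x < η * c / B := by
    have h0 : r x₀ = 0 := (hr.eq_zero_iff x₀ (Metric.mem_closedBall_self hρ.le)).2 hx₀
    have hca : ContinuousAt r x₀ :=
      hr.continuousOn.continuousAt (Metric.closedBall_mem_nhds x₀ hρ)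
    have hev : ∀ᶠ x in 𝓝 x₀, r x < η * c / B :=
      hca.eventually (gt_mem_nhds (by rw [h0]; positivity))
    obtain ⟨σ, hσ, hσs⟩ := Metric.nhds_basis_closedBall.eventually_iff.1 hev
    exact ⟨min σ ρ, lt_min hσ hρ, min_le_right _ _, fun x hx =>
      hσs (Metric.closedBall_subset_closedBall (min_le_left _ _) hx)⟩
  have hsub : Metric.closedBall x₀ ρ' ⊆ Metric.closedBall x₀ ρ :=
    Metric.closedBall_subset_closedBall hρ'ρ
  have hsubΩ : Metric.closedBall x₀ ρ' \ E ⊆ Ω \ E := fun x hx => ⟨hball (hsub hx.1), hx.2⟩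
  -- On the sphere, doubling the quadratic term lowers the barrier by `η ρ'²`, which pays for the
  -- added `δ`.
  set δ : ℝ := η * ρ' ^ 2 / 2 with hδ
  have hδ0 : 0 < δ := by positivity
  have hsqc : ContDiff ℝ 2 fun x : EuclideanSpace ℝ (Fin n) => ‖x - x₀‖ ^ 2 :=
    (contDiff_id.sub contDiff_const).norm_sq ℝ
  have hcomp : ∀ y ∈ Metric.closedBall x₀ ρ' \ E, ∀ ε > 0,
      η * (r y - 2 * ‖y - x₀‖ ^ 2) + δ ≤ u y - v y + ε := by
    intro y hy ε hε
    obtain ⟨W, hWc, hW0, hWy, hWE, hWtr⟩ := exists_potential hψ (p := y)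
      (fun w hw h => hy.2 (h ▸ hψE w hw)) x₀ ρ (ε := ε / δ) (by positivity)
    by_contra! hlt
    set h : EuclideanSpace ℝ (Fin n) → ℝ := fun x =>
      (η * (r x - 2 * ‖x - x₀‖ ^ 2) + δ) + δ * W x with hh
    have hsq2 : ContDiff ℝ 2 fun x : EuclideanSpace ℝ (Fin n) => 2 * ‖x - x₀‖ ^ 2 :=
      contDiff_const.mul hsqc
    have hhc : ContinuousOn h (Metric.closedBall x₀ ρ') :=
      ((continuousOn_const.mul ((hr.continuousOn.mono hsub).sub
        hsq2.continuous.continuousOn)).add continuousOn_const).add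
        (continuousOn_const.mul hWc.continuous.continuousOn)
    have hvc : ContinuousOn v (Metric.closedBall x₀ ρ') := hv.continuousOn.mono (hsub.trans hball)
    obtain ⟨x, hx, hmax, -⟩ := exists_isLocalMax_of_pos hE (x₀ := x₀) (ρ := ρ')
      (g := fun x => h x - (u x - v x)) (ψ := h)
      ((hhc.mono sdiff_subset).sub ((hu.continuousOn.mono hsubΩ).sub (hvc.mono sdiff_subset)))
      hhc (fun x hx => by linarith [huv x (hsubΩ hx)])
      (fun x hx => by
        have h0 := (hr.eq_zero_iff x (hsub hx.1)).2 hx.2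
        obtain ⟨w, hw, rfl⟩ := hEψ ⟨hx.2, hsub hx.1⟩
        have h1 := mul_le_mul_of_nonneg_left (hWE w hw) hδ0.le
        have h2 : 0 ≤ η * (2 * ‖ψ w - x₀‖ ^ 2) := by positivity
        simp only [hh, h0]
        linarith)
      (fun x hx => by
        have hxs := Metric.sphere_subset_closedBall hx.1
        have hdist : ‖x - x₀‖ = ρ' := by simpa [dist_eq_norm] using hx.1
        have h1 := hlin x ⟨hsub hxs, hx.2⟩
        have h2 := mul_le_mul_of_nonneg_left (hW0 x (hsub hxs)) hδ0.le
        have h3 : 0 < η * ρ' ^ 2 := by positivity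
        rw [hdist] at h1
        simp only [hh, hdist]
        linarith)
      hy (by
        have h1 := mul_le_mul_of_nonneg_left hWy hδ0.le
        have h2 : δ * -(ε / δ) = -ε := by field_simp
        simp only [hh]
        linarith)
    have hxc : x ∈ Metric.closedBall x₀ ρ' := Metric.ball_subset_closedBall hx.1
    have hxK := hsub hxc
    have hxΩ : x ∈ Ω \ E := hsubΩ ⟨hxc, hx.2⟩
    obtain ⟨hrc, -, hrtr, -⟩ := hr.regular x ⟨hxK, hx.2⟩
    have huc : ContDiffAt ℝ 2 u x := hu.contDiffAt (hΩE.mem_nhds hxΩ)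
    have hvc' : ContDiffAt ℝ 2 v x := hv.contDiffAt (hΩ.mem_nhds hxΩ.1)
    -- The frame is adapted to `u` alone; the trace bounds for `r` and `W` hold on every frame.
    obtain ⟨ξ, hξ, hξu⟩ := exists_orthonormal_sum_orderedEigenvalue (hessian_isSymm huc) hk
    simp only [hessian_quadratic huc] at hξu
    have hu0 : ∑ i, secondDeriv u x (ξ i) ≤ 0 := by rw [hξu]; exact hlam x hxΩ
    have hrsq : ContDiffAt ℝ 2 (fun x => r x - 2 * ‖x - x₀‖ ^ 2) x := hrc.sub hsq2.contDiffAt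
    have hc1 : ContDiffAt ℝ 2 (fun x => η * (r x - 2 * ‖x - x₀‖ ^ 2)) x :=
      contDiffAt_const.mul hrsq
    have hc2 : ContDiffAt ℝ 2 (fun x => η * (r x - 2 * ‖x - x₀‖ ^ 2) + δ) x :=
      hc1.add contDiffAt_const
    have hc3 : ContDiffAt ℝ 2 (fun x => δ * W x) x := contDiffAt_const.mul hWc.contDiffAt
    have hsecond : ∀ ζ, η * (secondDeriv r x ζ - 4 * ‖ζ‖ ^ 2) + δ * secondDeriv W x ζ -
        (secondDeriv u x ζ - secondDeriv v x ζ) ≤ 0 := by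
      intro ζ
      have h1 := hmax.secondDeriv_nonpos ((hc2.add hc3).sub (huc.sub hvc')) ζ
      rw [secondDeriv_sub (hc2.add hc3) (huc.sub hvc'), secondDeriv_sub huc hvc',
        secondDeriv_add hc2 hc3, secondDeriv_add hc1 contDiffAt_const, secondDeriv_const,
        secondDeriv_const_mul hrsq, secondDeriv_sub hrc hsq2.contDiffAt,
        secondDeriv_const_mul hsqc.contDiffAt, secondDeriv_norm_sub_sq,
        secondDeriv_const_mul hWc.contDiffAt] at h1
      linarith
    have hsum := Finset.sum_nonpos fun i (_ : i ∈ Finset.univ) => hsecond (ξ i)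
    simp only [Finset.sum_add_distrib, Finset.sum_sub_distrib, ← Finset.mul_sum, hξ.1, one_pow,
      Finset.sum_const, Finset.card_univ, Fintype.card_fin, nsmul_eq_mul, mul_one] at hsum
    have hvlow : -((k + 2 : ℕ) * |A|) ≤ ∑ i, secondDeriv v x (ξ i) := by
      have h1 : ∀ i ∈ Finset.univ, -|A| ≤ secondDeriv v x (ξ i) := by
        intro i _
        have h2 := (fderiv ℝ (fderiv ℝ v) x).le_opNorm₂ (ξ i) (ξ i)
        rw [hξ.1, mul_one, mul_one] at h2
        exact (abs_le.1 (h2.trans ((hA x hxK).trans (le_abs_self A)))).1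
      have h3 := Finset.card_nsmul_le_sum _ _ _ h1
      rw [Finset.card_univ, Fintype.card_fin, nsmul_eq_mul, mul_neg] at h3
      exact h3
    have hrpos : 0 < r x := lt_of_le_of_ne (hr.nonneg x) fun h0 =>
      hx.2 ((hr.eq_zero_iff x hxK).1 h0.symm)
    have hBr : B < η * (c / r x) := by
      have h1 := hrsmall x hxc
      rw [lt_div_iff₀ hB0] at h1
      rw [← mul_div_assoc, lt_div_iff₀ hrpos]
      linarith
    have hrη := mul_le_mul_of_nonneg_left (hrtr ξ hξ) hη.le
    have hWη := mul_nonneg hδ0.le (hWtr x ξ hξ)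
    rw [hB] at hBr
    nlinarith
  -- After `ε → 0`, within distance `ρ' / 4` the quadratic loss is at most `η ρ'² / 8 = δ / 4`.
  refine ⟨δ / 2, by positivity, ?_⟩
  filter_upwards [Metric.closedBall_mem_nhds x₀ (by positivity : 0 < ρ' / 4)] with x hx hxE
  have hxρ : x ∈ Metric.closedBall x₀ ρ' :=
    Metric.closedBall_subset_closedBall (by linarith) hx
  have h1 := le_of_forall_pos_le_add (hcomp x ⟨hxρ, hxE⟩)
  have h2 : ‖x - x₀‖ ≤ ρ' / 4 := by simpa [dist_eq_norm] using hx
  have h3 : ‖x - x₀‖ ^ 2 ≤ (ρ' / 4) ^ 2 := by gcongr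
  have h4 := mul_le_mul_of_nonneg_left h3 hη.le
  have h5 := mul_nonneg hη.le (hr.nonneg x)
  have h6 : 0 < η * ρ' ^ 2 := by positivity
  rw [hδ] at h1 ⊢
  nlinarith

theorem IsDefiningFunction.mono (hr : IsDefiningFunction k E x₀ r ρ c C) {ρ' : ℝ} (hρ' : 0 < ρ')
    (h : ρ' ≤ ρ) : IsDefiningFunction k E x₀ r ρ' c C where
  radius_pos := hρ'
  lower_pos := hr.lower_pos
  upper_pos := hr.upper_pos
  nonneg := hr.nonneg
  continuousOn := hr.continuousOn.mono (Metric.closedBall_subset_closedBall h)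
  eq_zero_iff x hx := hr.eq_zero_iff x (Metric.closedBall_subset_closedBall h hx)
  regular x hx := hr.regular x ⟨Metric.closedBall_subset_closedBall h hx.1, hx.2⟩

end PositiveBound

/-! ### Globalization by compactness -/

theorem theorem1p2 {n k : ℕ} (hk : k + 2 ≤ n)
    (Ω : Set (EuclideanSpace ℝ (Fin n)))
    (hΩo : IsOpen Ω) (hΩc : IsConnected Ω) (hΩb : Bornology.IsBounded Ω)
    (F : EuclideanSpace ℝ (Fin n) × ℝ × EuclideanSpace ℝ (Fin n) × Matrix (Fin n) (Fin n) ℝ → ℝ)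
    (hF : ContDiffOn ℝ 1 F (Ω ×ˢ univ ×ˢ univ ×ˢ {M | M.IsSymm}))
    (hell : IsEllipticOn F Ω)
    (E : Set (EuclideanSpace ℝ (Fin n)))
    (hE : IsSmoothClosedSubmanifold k E) (hEΩ : E ⊆ Ω)
    (u v : EuclideanSpace ℝ (Fin n) → ℝ)
    (hu : ContDiffOn ℝ 2 u (Ω \ E)) (hv : ContDiffOn ℝ 2 v Ω)
    (hlam : ∀ x ∈ Ω \ E, ∑ i ∈ Finset.range (k + 2), orderedEigenvalue (hessian u x) i ≤ 0)
    (huv : ∀ x ∈ Ω \ E, v x < u x)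
    (hFuv : ∀ x ∈ Ω \ E,
      F (x, v x, gradient v x, hessian v x) ≤ F (x, u x, gradient u x, hessian u x)) :
    0 < liminf (fun x => ((u x - v x : ℝ) : EReal))
      (comap (fun x => Metric.infEDist x E) (𝓝 0) ⊓ 𝓟 (Ω \ E)) := by
  have hlocal : ∀ x₀ ∈ E, ∃ δ : ℝ, 0 < δ ∧ ∀ᶠ x in 𝓝 x₀, x ∉ E → δ ≤ u x - v x := by
    intro x₀ hx₀
    obtain ⟨r, ρ, c, C, hball, hr⟩ := hE.exists_defining_function hk hΩo hx₀ (hEΩ hx₀)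
    obtain ⟨η, ρ₁, hη, hρ₁, hρ₁ρ, hlin⟩ := hr.exists_linear_lower_bound hx₀ hE.1.isClosed hΩo hball
      hF hell hu hv huv hFuv
    obtain ⟨ψ, L, ρ₂, hρ₂, hψ, hψE, hEψ⟩ := hE.exists_parametrization (by omega) hx₀
    have h1 : Metric.closedBall x₀ (min ρ₁ ρ₂) ⊆ Metric.closedBall x₀ ρ₁ :=
      Metric.closedBall_subset_closedBall (min_le_left _ _)
    have h2 : Metric.closedBall x₀ (min ρ₁ ρ₂) ⊆ Metric.closedBall x₀ ρ₂ :=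
      Metric.closedBall_subset_closedBall (min_le_right _ _)
    exact (hr.mono (lt_min hρ₁ hρ₂) ((min_le_left _ _).trans hρ₁ρ)).exists_pos_lower_bound hk hx₀
      hE.1.isClosed hΩo (h1.trans ((Metric.closedBall_subset_closedBall hρ₁ρ).trans hball)) hψ hψE
      ((inter_subset_inter_right _ h2).trans hEψ) hu hv hlam huv hη
      fun x hx => hlin x ⟨h1 hx.1, hx.2⟩
  obtain ⟨δ, hδ, hev⟩ : ∃ δ : ℝ, 0 < δ ∧ ∀ᶠ x in 𝓝ˢ E, x ∉ E → δ ≤ u x - v x := by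
    refine hE.1.induction_on (p := fun s => ∃ δ : ℝ, 0 < δ ∧ ∀ᶠ x in 𝓝ˢ s, x ∉ E → δ ≤ u x - v x)
      ⟨1, one_pos, by simp⟩ ?_ ?_ ?_
    · rintro s t hst ⟨δ, hδ, h⟩
      exact ⟨δ, hδ, h.filter_mono (nhdsSet_mono hst)⟩
    · rintro s t ⟨δ, hδ, h⟩ ⟨δ', hδ', h'⟩
      refine ⟨min δ δ', lt_min hδ hδ', ?_⟩
      rw [nhdsSet_union, eventually_sup]
      exact ⟨h.mono fun x hx hxE => (min_le_left _ _).trans (hx hxE),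
        h'.mono fun x hx hxE => (min_le_right _ _).trans (hx hxE)⟩
    · intro x₀ hx₀
      obtain ⟨δ, hδ, h⟩ := hlocal x₀ hx₀
      obtain ⟨t, ht, hto, hxt⟩ := eventually_nhds_iff.1 h
      exact ⟨t, mem_nhdsWithin_of_mem_nhds (hto.mem_nhds hxt), δ, hδ,
        mem_of_superset (hto.mem_nhdsSet.2 Subset.rfl) ht⟩
  obtain ⟨U, hUo, hEU, hU⟩ := eventually_nhdsSet_iff_exists.1 hev
  -- Compactness turns the neighbourhood of `E` into a uniform one. For empty `E` the distance is
  -- `∞`, the filter is trivial and the lower limit is `+∞`.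
  obtain ⟨τ, hτ, hτU⟩ := hE.1.exists_thickening_subset_open hUo hEU
  refine lt_of_lt_of_le (EReal.coe_pos.2 hδ) (le_liminf_of_le (by isBoundedDefault) ?_)
  rw [eventually_inf_principal]
  have hsmall : ∀ᶠ x in comap (fun x => Metric.infEDist x E) (𝓝 0),
      Metric.infEDist x E < ENNReal.ofReal τ :=
    tendsto_comap.eventually (gt_mem_nhds (ENNReal.ofReal_pos.2 hτ))
  filter_upwards [hsmall] with x hx hxΩ
  exact EReal.coe_le_coe_iff.2 (hU x (hτU hx) hxΩ.2)
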